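/- Let $(\Omega,\mathcal A,\mathbb P)$ be a probability space. Write $\mathcal B_B(E)$ for the bounded Borel subsets of $E$. A \emph{real measure} on $E$ is a $\sigma$-additive function $\mathcal B_B(E)\to\mathbb R$, and a \emph{random measure} on $E$ is a $\sigma$-additive function $M:\mathcal B_B(E)\to L^2(\Omega,\mathcal A,\mathbb P)$ with real values for which there is a real measure $C_M$ on $E\times E$ with $C_M(A\times B)=\mathrm{Cov}(M(A),M(B))$ for all $A,B\in\mathcal B_B(E)$. For a bounded measurable $\varphi:E\to\mathbb C$ with bounded support, $\langle M,\varphi\rangle=\int\varphi\,dM$ is the $L^2$-limit of the integrals of simple functions that converge uniformly to $\varphi$ and are supported in a common bounded set. A \emph{Riemann system} of $D\in\mathcal B_B(E)$ is a sequence of finite tagged Borel partitions $(I^n_j,x^n_j)_j$ of $D$, $x_j^n\in I_j^n$, with $\max_j\mathrm{diam}(I^n_j)\to0$. For a mean-square continuous process $Z$ on $E$, the integral $\int_D Z\,dM$ is \emph{uniquely defined} if the Riemann sums $\sum_j Z(x^n_j)M(I^n_j)$ converge in $L^2$ along every Riemann system of $D$, to a limit that does not depend on the system. If $Z$ is null outside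 a bounded set, $\int_E Z\,dM$ is uniquely defined if the integrals $\int_D Z\,dM$ are, with a common value, for all $D\in\mathcal B_B(E)$ outside which $Z$ is null. \textbf{Theorem.} Let $M_1$ and $M_2$ be jointly Gaussian random measures on $\mathbb R^d$ and $\mathbb R^p$ respectively, and suppose that there is a real measure $C_{M_1,M_2}$ on $\mathbb R^d\times\mathbb R^p$ with $C_{M_1,M_2}(A\times B)=\mathrm{Cov}(M_1(A),M_2(B))$ for all $A\in\mathcal B_B(\mathbb R^d)$, $B\in\mathcal B_B(\mathbb R^p)$. Then there is a unique random measure $M_1\otimes M_2$ on $\mathbb R^d\times\mathbb R^p$ with $(M_1\otimes M_2)(A\times B)=M_1(A)M_2(B)$ for all such $A,B$, and for every continuous compactly supported $\psi:\mathbb R^d\times\mathbb R^p\to\mathbb C$ the processes $y\mapsto\int_{\mathbb R^d}\psi(x,y)\,dM_1(x)$ and $x\mapsto\int_{\mathbb R^p}\psi(x,y)\,dM_2(y)$ are mean-square continuous and null outside bounded sets, both iterated stochastic integrals below are uniquely defined (in the $L^2$ sense), and $$\int_{\mathbb R^p}\int_{\mathbb R^d}\psi(x,y)\,dM_1(x)\,dM_2(y)=\langle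 M_1\otimes M_2,\psi\rangle=\int_{\mathbb R^d}\int_{\mathbb R^p}\psi(x,y)\,dM_2(y)\,dM_1(x).$$ -/

import Mathlib

open MeasureTheory ProbabilityTheory Filter Topology
open scoped ENNReal

namespace RandomMeasures

noncomputable section

/-- The bounded Borel subsets of a space. -/
def BoundedBorel (E : Type*) [MeasurableSpace E] [PseudoMetricSpace E] : Type _ :=
  {A : Set E // MeasurableSet A ∧ Bornology.IsBounded A}

/-- The underlying set of a bounded Borel set. -/
def BoundedBorel.toSet {E : Type*} [MeasurableSpace E] [PseudoMetricSpace E]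
    (A : BoundedBorel E) : Set E :=
  A.1

/-- The product `A × B` of two bounded Borel sets. -/
def BoundedBorel.prod {E F : Type*} [MeasurableSpace E] [PseudoMetricSpace E]
    [MeasurableSpace F] [PseudoMetricSpace F] (A : BoundedBorel E) (B : BoundedBorel F) :
    BoundedBorel (E × F) :=
  ⟨A.toSet ×ˢ B.toSet, A.2.1.prod B.2.1, A.2.2.prod B.2.2⟩

/-- `σ`-additivity of a set function on the bounded Borel sets: `m (⋃ Aₙ) = ∑ m (Aₙ)` for
pairwise disjoint bounded Borel sets `Aₙ` whose union is bounded. -/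
def IsSigmaAdditive {E V : Type*} [MeasurableSpace E] [PseudoMetricSpace E]
    [AddCommMonoid V] [TopologicalSpace V] (m : BoundedBorel E → V) : Prop :=
  ∀ (A : ℕ → BoundedBorel E) (B : BoundedBorel E),
    Pairwise (fun i j => Disjoint (A i).toSet (A j).toSet) →
    (⋃ n, (A n).toSet) = B.toSet → HasSum (fun n => m (A n)) (m B)

/-- A second-order random measure whose covariance structure is determined by a (locally finite,
signed) real measure on `E × E`. -/
structure IsRandomMeasure {Ω E : Type*} [MeasurableSpace Ω] [MeasurableSpace E]
    [PseudoMetricSpace E] (P : Measure Ω) (M : BoundedBorel E → Lp ℝ 2 P) : Prop where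
  sigmaAdditive : IsSigmaAdditive M
  exists_covariance : ∃ C : BoundedBorel (E × E) → ℝ, IsSigmaAdditive C ∧
    ∀ A B : BoundedBorel E, C (A.prod B) = cov[M A, M B; P]

/-- All the vectors `(M₁ (A₁), …, M₁ (Aₙ), M₂ (B₁), …, M₂ (Bₘ))` are Gaussian. -/
def JointlyGaussian {Ω E F : Type*} [MeasurableSpace Ω] [MeasurableSpace E] [PseudoMetricSpace E]
    [MeasurableSpace F] [PseudoMetricSpace F] (P : Measure Ω)
    (M₁ : BoundedBorel E → Lp ℝ 2 P) (M₂ : BoundedBorel F → Lp ℝ 2 P) : Prop :=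
  IsGaussianProcess
    (Sum.elim (fun (A : BoundedBorel E) (ω : Ω) => M₁ A ω)
      (fun (B : BoundedBorel F) (ω : Ω) => M₂ B ω)) P

/-- The cross-covariance structure of `M₁` and `M₂` is determined by a real measure. -/
def HasCrossCovarianceMeasure {Ω E F : Type*} [MeasurableSpace Ω] [MeasurableSpace E]
    [PseudoMetricSpace E] [MeasurableSpace F] [PseudoMetricSpace F] (P : Measure Ω)
    (M₁ : BoundedBorel E → Lp ℝ 2 P) (M₂ : BoundedBorel F → Lp ℝ 2 P) : Prop :=
  ∃ C : BoundedBorel (E × F) → ℝ, IsSigmaAdditive C ∧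
    ∀ (A : BoundedBorel E) (B : BoundedBorel F), C (A.prod B) = cov[M₁ A, M₂ B; P]

/-- `T` is a tensor product of `M₁` and `M₂`: a random measure on the product space with
`T (A × B) = M₁ (A) M₂ (B)` almost surely. -/
structure IsTensorRandomMeasure {Ω E F : Type*} [MeasurableSpace Ω] [MeasurableSpace E]
    [PseudoMetricSpace E] [MeasurableSpace F] [PseudoMetricSpace F] (P : Measure Ω)
    (M₁ : BoundedBorel E → Lp ℝ 2 P) (M₂ : BoundedBorel F → Lp ℝ 2 P)
    (T : BoundedBorel (E × F) → Lp ℝ 2 P) : Prop where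
  isRandomMeasure : IsRandomMeasure P T
  apply_prod : ∀ (A : BoundedBorel E) (B : BoundedBorel F),
    ∀ᵐ ω ∂P, T (A.prod B) ω = M₁ A ω * M₂ B ω

/-! ### Integration of a deterministic function against a random measure -/

/-- A simple function `∑ᵢ cᵢ 𝟙_{Aᵢ}`, with complex `cᵢ` and bounded Borel sets `Aᵢ`. -/
structure SimpleFn (E : Type*) [MeasurableSpace E] [PseudoMetricSpace E] where
  size : ℕ
  coeff : Fin size → ℂ
  set : Fin size → BoundedBorel E

/-- The values of a simple function. -/
def SimpleFn.eval {E : Type*} [MeasurableSpace E] [PseudoMetricSpace E]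
    (s : SimpleFn E) (x : E) : ℂ :=
  ∑ i, (s.set i).toSet.indicator (fun _ => s.coeff i) x

/-- The integral `∑ᵢ cᵢ M (Aᵢ)` of a simple function. -/
def SimpleFn.integral {Ω E : Type*} [MeasurableSpace Ω] [MeasurableSpace E]
    [PseudoMetricSpace E] {P : Measure Ω} (s : SimpleFn E) (M : BoundedBorel E → Lp ℝ 2 P) :
    Lp ℂ 2 P :=
  ∑ i, s.coeff i • Complex.ofRealCLM.compLp (M (s.set i))

/-- The simple functions `s n` are supported in a common bounded set and converge uniformly
to `φ`. -/
def Approximates {E : Type*} [MeasurableSpace E] [PseudoMetricSpace E]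
    (s : ℕ → SimpleFn E) (φ : E → ℂ) : Prop :=
  (∃ D : BoundedBorel E, ∀ n i, ((s n).set i).toSet ⊆ D.toSet) ∧
    TendstoUniformly (fun n => (s n).eval) φ atTop

/-- `⟨M, φ⟩ = ∫ φ dM` exists and equals `X`, as the integral of a bounded measurable function `φ`
with bounded support against an `L²`-valued measure: `φ` is the uniform limit of simple functions
supported in a common bounded set, and the integrals of any such sequence converge to `X`
in `L²`. -/
structure HasIntegral {Ω E : Type*} [MeasurableSpace Ω] [MeasurableSpace E]
    [PseudoMetricSpace E] {P : Measure Ω} (M : BoundedBorel E → Lp ℝ 2 P) (φ : E → ℂ)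
    (X : Lp ℂ 2 P) : Prop where
  exists_approx : ∃ s : ℕ → SimpleFn E, Approximates s φ
  tendsto : ∀ s : ℕ → SimpleFn E, Approximates s φ →
    Tendsto (fun n => (s n).integral M) atTop (𝓝 X)

/-! ### Integration of a process against a random measure -/

/-- A Riemann system of `D`: a sequence of finite tagged Borel partitions of `D` whose meshes tend
to `0`. When `D` is infinite, the number of cells then tends to infinity; a finite `D`, whose
finite partitions have boundedly many nonempty cells, is not excluded. -/
structure RiemannSystem {E : Type*} [MeasurableSpace E] [PseudoMetricSpace E]
    (D : BoundedBorel E) where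
  size : ℕ → ℕ
  cell : (n : ℕ) → Fin (size n) → BoundedBorel E
  tag : (n : ℕ) → Fin (size n) → E
  disjoint : ∀ n, Pairwise (fun i j => Disjoint (cell n i).toSet (cell n j).toSet)
  iUnion_eq : ∀ n, (⋃ j, (cell n j).toSet) = D.toSet
  tag_mem : ∀ n j, tag n j ∈ (cell n j).toSet
  mesh_tendsto : Tendsto (fun n => ⨆ j, Metric.ediam (cell n j).toSet) atTop (𝓝 0)

/-- The Riemann sum `∑ⱼ Z (xⱼⁿ) M (Iⱼⁿ)`. -/
def RiemannSystem.sum {Ω E : Type*} [MeasurableSpace Ω] [MeasurableSpace E]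
    [PseudoMetricSpace E] {P : Measure Ω} {D : BoundedBorel E} (R : RiemannSystem D)
    (Z : E → Lp ℂ 2 P) (M : BoundedBorel E → Lp ℝ 2 P) (n : ℕ) (ω : Ω) : ℂ :=
  ∑ j, Z (R.tag n j) ω * (M (R.cell n j) ω : ℂ)

/-- The stochastic integral `∫_D Z dM` is uniquely defined in the `L²` sense, with value `X`:
Riemann systems of `D` exist, and the Riemann sums along each of them converge to `X`
in `L²`. -/
structure HasStochIntegralOn {Ω E : Type*} [MeasurableSpace Ω] [MeasurableSpace E]
    [PseudoMetricSpace E] {P : Measure Ω} (Z : E → Lp ℂ 2 P) (M : BoundedBorel E → Lp ℝ 2 P)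
    (D : BoundedBorel E) (X : Lp ℂ 2 P) : Prop where
  nonempty : Nonempty (RiemannSystem D)
  tendsto : ∀ R : RiemannSystem D,
    Tendsto (fun n => eLpNorm (fun ω => R.sum Z M n ω - X ω) 2 P) atTop (𝓝 0)

/-- The stochastic integral `∫ Z dM` over the whole space, of a mean-square continuous process `Z`
which is null outside a bounded set, is uniquely defined in the `L²` sense, with value `X`:
for every bounded Borel `D` outside which `Z` is null, `∫_D Z dM` is, with that value. -/
structure HasStochIntegral {Ω E : Type*} [MeasurableSpace Ω] [MeasurableSpace E]
    [PseudoMetricSpace E] {P : Measure Ω} (Z : E → Lp ℂ 2 P) (M : BoundedBorel E → Lp ℝ 2 P)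
    (X : Lp ℂ 2 P) : Prop where
  continuous : ∀ x₀ : E, Tendsto Z (𝓝 x₀) (𝓝 (Z x₀))
  exists_null_outside : ∃ D : BoundedBorel E, ∀ x ∉ D.toSet, Z x = 0
  hasStochIntegralOn : ∀ D : BoundedBorel E, (∀ x ∉ D.toSet, Z x = 0) →
    HasStochIntegralOn Z M D X

/-! ### The integrals are determined by the definitions -/

theorem HasIntegral.unique {Ω E : Type*} [MeasurableSpace Ω] [MeasurableSpace E]
    [PseudoMetricSpace E] {P : Measure Ω} {M : BoundedBorel E → Lp ℝ 2 P} {φ : E → ℂ}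
    {X Y : Lp ℂ 2 P} (hX : HasIntegral M φ X) (hY : HasIntegral M φ Y) : X = Y := by
  obtain ⟨s, hs⟩ := hX.exists_approx
  exact tendsto_nhds_unique (hX.tendsto s hs) (hY.tendsto s hs)

theorem HasStochIntegralOn.unique {Ω E : Type*} [MeasurableSpace Ω] [MeasurableSpace E]
    [PseudoMetricSpace E] {P : Measure Ω} {Z : E → Lp ℂ 2 P} {M : BoundedBorel E → Lp ℝ 2 P}
    {D : BoundedBorel E} {X Y : Lp ℂ 2 P} (hX : HasStochIntegralOn Z M D X)
    (hY : HasStochIntegralOn Z M D Y) : X = Y := by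
  obtain ⟨R⟩ := hX.nonempty
  have hmeas : ∀ n, AEStronglyMeasurable (R.sum Z M n) P := by
    intro n
    refine Finset.aestronglyMeasurable_fun_sum _ fun j _ => ?_
    exact (Lp.aestronglyMeasurable _).mul
      (Complex.continuous_ofReal.comp_aestronglyMeasurable (Lp.aestronglyMeasurable _))
  have hle : ∀ n, eLpNorm (X - Y : Lp ℂ 2 P) 2 P ≤
      eLpNorm (fun ω => R.sum Z M n ω - Y ω) 2 P
        + eLpNorm (fun ω => R.sum Z M n ω - X ω) 2 P := by
    intro n
    have h : eLpNorm (X - Y : Lp ℂ 2 P) 2 P =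
        eLpNorm ((fun ω => R.sum Z M n ω - Y ω) - (fun ω => R.sum Z M n ω - X ω)) 2 P := by
      refine eLpNorm_congr_ae ?_
      filter_upwards [Lp.coeFn_sub X Y] with ω hω
      rw [hω]
      simp
    rw [h]
    exact eLpNorm_sub_le ((hmeas n).sub (Lp.aestronglyMeasurable _))
      ((hmeas n).sub (Lp.aestronglyMeasurable _)) (by norm_num)
  have h0 : eLpNorm (X - Y : Lp ℂ 2 P) 2 P ≤ 0 := by
    have := (hY.tendsto R).add (hX.tendsto R)
    rw [add_zero] at this
    exact ge_of_tendsto' this hle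
  have h1 : X - Y = 0 := by
    rw [← norm_eq_zero, Lp.norm_def, nonpos_iff_eq_zero.mp h0, ENNReal.toReal_zero]
  exact sub_eq_zero.mp h1

theorem HasStochIntegral.unique {Ω E : Type*} [MeasurableSpace Ω] [MeasurableSpace E]
    [PseudoMetricSpace E] {P : Measure Ω} {Z : E → Lp ℂ 2 P} {M : BoundedBorel E → Lp ℝ 2 P}
    {X Y : Lp ℂ 2 P} (hX : HasStochIntegral Z M X) (hY : HasStochIntegral Z M Y) : X = Y := by
  obtain ⟨D, hD⟩ := hX.exists_null_outside
  exact (hX.hasStochIntegralOn D hD).unique (hY.hasStochIntegralOn D hD)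

end

end RandomMeasures

open RandomMeasures

namespace RandomMeasures

/-! ### Set functions on the bounded Borel sets -/

section SigmaAdditive

variable {E F V : Type*} [MeasurableSpace E] [PseudoMetricSpace E] [MeasurableSpace F]
  [PseudoMetricSpace F]

/-! The values `M₁ A * M₂ B` on rectangles are prescribed, so everything rests on their Gram matrix.
By Isserlis' formula, the moment of `M₁ A * M₂ B * M₁ A' * M₂ B'` is a sum of three products of
second moments minus twice the product of the four means. Each term is a real measure evaluated on
`(A × B) × (A' × B')`, because second moments and means are real measures and products of real
measures exist (`exists_fourthMoment`).

A Gram matrix given by a real measure `G` allows an extension. Write `G` as a difference of two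
locally finite measures, restrict both to a bounded square, and let `ν` be the sum of their
marginals. The quadratic form of `G` on simple functions is then at most the squared `L²(ν)` norm
(`IsSigmaAdditive.exists_dominating`). Hence sending the indicator of `A × B` to `M₁ A * M₂ B`
extends to a continuous linear map on `L²(ν)`, and the images of all indicators form a `σ`-additive
set function. These local extensions agree by a π-λ argument and are glued
(`exists_isSigmaAdditive_of_gram_prod`). The π-λ argument also gives uniqueness.

The same domination bounds `∫ φ dM` by a multiple of the supremum of `|φ|`, for `φ` supported in a
fixed bounded set (`BoundedSemivariation`). For the iterated integrals, `Z(y) M₂(I)` is the integral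
of `ψ(·, y) 𝟙_I` against the tensor product (`coeFn_integral_prodRight`). A Riemann sum is therefore
the integral of a function that is `ψ` with its second variable frozen at the tags. By uniform
continuity this function is uniformly close to `ψ` (`tendsto_riemannSum`). The other order follows
by exchanging the variables. -/

theorem BoundedBorel.ext {A B : BoundedBorel E} (h : A.toSet = B.toSet) : A = B :=
  Subtype.ext h

theorem BoundedBorel.measurableSet (A : BoundedBorel E) : MeasurableSet A.toSet := A.2.1

theorem BoundedBorel.isBounded (A : BoundedBorel E) : Bornology.IsBounded A.toSet := A.2.2

/-- The part of a measurable set that lies in a bounded Borel set. -/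
def BoundedBorel.trace (D : BoundedBorel E) (U : Set E) (hU : MeasurableSet U) :
    BoundedBorel E :=
  ⟨U ∩ D.toSet, hU.inter D.2.1, D.2.2.subset Set.inter_subset_right⟩

/-- The intersection of two bounded Borel sets. -/
def BoundedBorel.inter (A D : BoundedBorel E) : BoundedBorel E := D.trace A.toSet A.2.1

@[simp] theorem BoundedBorel.toSet_trace (D : BoundedBorel E) (U : Set E) (hU : MeasurableSet U) :
    (D.trace U hU).toSet = U ∩ D.toSet := rfl

@[simp] theorem BoundedBorel.toSet_inter (A D : BoundedBorel E) :
    (A.inter D).toSet = A.toSet ∩ D.toSet := rfl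

@[simp] theorem BoundedBorel.toSet_prod (A : BoundedBorel E) (B : BoundedBorel F) :
    (A.prod B).toSet = A.toSet ×ˢ B.toSet := rfl

theorem BoundedBorel.inter_eq_left {A D : BoundedBorel E} (h : A.toSet ⊆ D.toSet) :
    A.inter D = A :=
  BoundedBorel.ext (Set.inter_eq_left.mpr h)

theorem BoundedBorel.prod_inter_prod (A A' : BoundedBorel E) (B B' : BoundedBorel F) :
    (A.prod B).inter (A'.prod B') = (A.inter A').prod (B.inter B') :=
  BoundedBorel.ext Set.prod_inter_prod

section Group

variable [AddCommGroup V] [TopologicalSpace V] [IsTopologicalAddGroup V] [T2Space V]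

/-- The constant sequence of empty sets is disjoint with empty union, and a summable constant family
in a Hausdorff group is zero. -/
theorem IsSigmaAdditive.apply_eq_zero {m : BoundedBorel E → V} (hm : IsSigmaAdditive m)
    {A : BoundedBorel E} (hA : A.toSet = ∅) : m A = 0 := by
  have h := hm (fun _ => A) A (fun i j _ => by simp [hA]) (by simp [hA])
  exact tendsto_nhds_unique tendsto_const_nhds h.summable.tendsto_atTop_zero

open Classical in
/-- The vector measure `U ↦ m (U ∩ D)`. -/
noncomputable def IsSigmaAdditive.localize {m : BoundedBorel E → V} (hm : IsSigmaAdditive m)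
    (D : BoundedBorel E) : VectorMeasure E V where
  measureOf' U := if h : MeasurableSet U then m (D.trace U h) else 0
  empty' := by
    simp only [MeasurableSet.empty, dite_true]
    exact hm.apply_eq_zero (by simp)
  not_measurable' U hU := by simp [hU]
  m_iUnion' f hf hd := by
    simp only [hf, MeasurableSet.iUnion hf, dite_true]
    refine hm _ _ (fun i j hij => ?_) ?_
    · exact (hd hij).mono Set.inter_subset_left Set.inter_subset_left
    · simp [Set.iUnion_inter]

theorem IsSigmaAdditive.localize_apply {m : BoundedBorel E → V} (hm : IsSigmaAdditive m)
    (D : BoundedBorel E) {U : Set E} (hU : MeasurableSet U) :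
    hm.localize D U = m (D.trace U hU) :=
  dif_pos hU

theorem IsSigmaAdditive.localize_toSet {m : BoundedBorel E → V} (hm : IsSigmaAdditive m)
    (A D : BoundedBorel E) : hm.localize D A.toSet = m (A.inter D) :=
  dif_pos A.2.1

/-- A `σ`-additive set function on a product is determined by its values on the rectangles. -/
theorem IsSigmaAdditive.ext_prod {m m' : BoundedBorel (E × F) → V} (hm : IsSigmaAdditive m)
    (hm' : IsSigmaAdditive m')
    (h : ∀ (A : BoundedBorel E) (B : BoundedBorel F), m (A.prod B) = m' (A.prod B))
    (o : E × F) [OpensMeasurableSpace E] [OpensMeasurableSpace F] : m = m' := by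
  funext U
  obtain ⟨r, hr⟩ := U.2.2.subset_closedBall o
  let D₁ : BoundedBorel E :=
    ⟨Metric.closedBall o.1 r, Metric.isClosed_closedBall.measurableSet, Metric.isBounded_closedBall⟩
  let D₂ : BoundedBorel F :=
    ⟨Metric.closedBall o.2 r, Metric.isClosed_closedBall.measurableSet, Metric.isBounded_closedBall⟩
  have hU : U.toSet ⊆ (D₁.prod D₂).toSet := by
    intro x hx
    have := hr hx
    rwa [← closedBall_prod_same] at this
  -- π-λ: rectangles form a generating π-system, and the total values agree because the localizing
  -- set is itself a rectangle.
  have key : hm.localize (D₁.prod D₂) = hm'.localize (D₁.prod D₂) := by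
    refine VectorMeasure.ext_of_generateFrom _ ?_ generateFrom_prod.symm isPiSystem_prod ?_
    · rintro _ ⟨A, hA, B, hB, rfl⟩
      have hA : MeasurableSet A := hA
      have hB : MeasurableSet B := hB
      rw [hm.localize_apply _ (hA.prod hB), hm'.localize_apply _ (hA.prod hB)]
      have : (D₁.prod D₂).trace (A ×ˢ B) (hA.prod hB) = (D₁.trace A hA).prod (D₂.trace B hB) :=
        BoundedBorel.ext Set.prod_inter_prod
      rw [this, h]
    · rw [hm.localize_apply _ MeasurableSet.univ, hm'.localize_apply _ MeasurableSet.univ]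
      have : (D₁.prod D₂).trace Set.univ MeasurableSet.univ = D₁.prod D₂ :=
        BoundedBorel.ext (Set.univ_inter _)
      rw [this, h]
  have := congrArg (fun v : VectorMeasure (E × F) V => v U.toSet) key
  simpa only [IsSigmaAdditive.localize_toSet, BoundedBorel.inter_eq_left hU] using this

end Group

theorem IsSigmaAdditive.add [AddCommMonoid V] [TopologicalSpace V] [ContinuousAdd V]
    {m m' : BoundedBorel E → V} (hm : IsSigmaAdditive m) (hm' : IsSigmaAdditive m') :
    IsSigmaAdditive (fun A => m A + m' A) :=
  fun A B hd hB => (hm A B hd hB).add (hm' A B hd hB)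

theorem IsSigmaAdditive.sub [AddCommGroup V] [TopologicalSpace V] [IsTopologicalAddGroup V]
    {m m' : BoundedBorel E → V} (hm : IsSigmaAdditive m) (hm' : IsSigmaAdditive m') :
    IsSigmaAdditive (fun A => m A - m' A) :=
  fun A B hd hB => (hm A B hd hB).sub (hm' A B hd hB)

theorem IsSigmaAdditive.map_clm {V W : Type*} [AddCommGroup V] [Module ℝ V] [TopologicalSpace V]
    [AddCommGroup W] [Module ℝ W] [TopologicalSpace W] {m : BoundedBorel E → V}
    (hm : IsSigmaAdditive m) (L : V →L[ℝ] W) : IsSigmaAdditive (fun A => L (m A)) :=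
  fun A B hd hB => (hm A B hd hB).mapL L

/-- The preimage of a bounded Borel set under a measurable map that pulls back bounded sets to
bounded sets. -/
def BoundedBorel.preimage (g : E → F) (hg : Measurable g)
    (hb : ∀ U : Set F, Bornology.IsBounded U → Bornology.IsBounded (g ⁻¹' U))
    (U : BoundedBorel F) : BoundedBorel E :=
  ⟨g ⁻¹' U.toSet, hg U.2.1, hb _ U.2.2⟩

theorem IsSigmaAdditive.comp_preimage [AddCommMonoid V] [TopologicalSpace V]
    {m : BoundedBorel E → V} (hm : IsSigmaAdditive m) (g : E → F) (hg : Measurable g)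
    (hb : ∀ U : Set F, Bornology.IsBounded U → Bornology.IsBounded (g ⁻¹' U)) :
    IsSigmaAdditive (fun U => m (BoundedBorel.preimage g hg hb U)) := by
  intro A B hd hB
  refine hm _ _ (fun i j hij => (hd hij).preimage g) ?_
  simp only [BoundedBorel.preimage, BoundedBorel.toSet] at hB ⊢
  rw [← hB, Set.preimage_iUnion]

/-- `σ`-additivity of the sections `A ↦ m (A × B)`. -/
theorem IsSigmaAdditive.prod_right [AddCommMonoid V] [TopologicalSpace V]
    {m : BoundedBorel (E × F) → V} (hm : IsSigmaAdditive m) (B : BoundedBorel F) :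
    IsSigmaAdditive (fun A => m (A.prod B)) := by
  intro A A' hd hA
  refine hm _ _ (fun i j hij => ?_) ?_
  · exact Set.disjoint_prod.mpr (Or.inl (hd hij))
  · simp only [BoundedBorel.toSet_prod]
    rw [← hA, Set.iUnion_prod_const]

theorem IsSigmaAdditive.prod_left [AddCommMonoid V] [TopologicalSpace V]
    {m : BoundedBorel (E × F) → V} (hm : IsSigmaAdditive m) (A : BoundedBorel E) :
    IsSigmaAdditive (fun B => m (A.prod B)) := by
  intro B B' hd hB
  refine hm _ _ (fun i j hij => ?_) ?_
  · exact Set.disjoint_prod.mpr (Or.inr (hd hij))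
  · simp only [BoundedBorel.toSet_prod]
    rw [← hB, Set.prod_iUnion]

end SigmaAdditive

/-! ### Real measures as differences of locally finite measures -/

section Real

variable {E F : Type*} [MeasurableSpace E] [PseudoMetricSpace E] [MeasurableSpace F]
  [PseudoMetricSpace F]

/-- A measure which is finite on bounded Borel sets. -/
def FiniteOnBounded (μ : Measure E) : Prop := ∀ A : BoundedBorel E, μ A.toSet < ∞

theorem FiniteOnBounded.sigmaFinite [OpensMeasurableSpace E] {μ : Measure E}
    (hμ : FiniteOnBounded μ) (o : E) : SigmaFinite μ where
  out' := ⟨{  set := fun n : ℕ => Metric.closedBall o n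
              set_mem := fun _ => trivial
              finite := fun _ => hμ ⟨_, Metric.isClosed_closedBall.measurableSet,
                Metric.isBounded_closedBall⟩
              spanning := Metric.iUnion_closedBall_nat o }⟩

theorem FiniteOnBounded.isSigmaAdditive {μ : Measure E} (hμ : FiniteOnBounded μ) :
    IsSigmaAdditive (fun A => μ.real A.toSet) := by
  intro A B hd hB
  have h : μ B.toSet = ∑' n, μ (A n).toSet := by
    rw [← hB, measure_iUnion hd fun n => (A n).2.1]
  have h' : ∑' n, μ (A n).toSet ≠ ∞ := h ▸ (hμ B).ne
  simp only [Measure.real, h]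
  rw [ENNReal.tsum_toReal_eq fun n => (hμ _).ne]
  exact (ENNReal.summable_toReal h').hasSum

theorem FiniteOnBounded.add {μ ν : Measure E} (hμ : FiniteOnBounded μ)
    (hν : FiniteOnBounded ν) : FiniteOnBounded (μ + ν) := fun A => by
  simpa using ⟨hμ A, hν A⟩

theorem FiniteOnBounded.prod [OpensMeasurableSpace E] [OpensMeasurableSpace F] {μ : Measure E}
    {ν : Measure F} (hμ : FiniteOnBounded μ)
    (hν : FiniteOnBounded ν) (o : E × F) : FiniteOnBounded (μ.prod ν) := fun U => by
  have := hμ.sigmaFinite o.1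
  have := hν.sigmaFinite o.2
  obtain ⟨r, hr⟩ := U.2.2.subset_closedBall o
  refine (measure_mono hr).trans_lt ?_
  rw [← closedBall_prod_same, Measure.prod_prod]
  refine ENNReal.mul_lt_top (hμ ⟨_, ?_, ?_⟩) (hν ⟨_, ?_, ?_⟩)
  exacts [Metric.isClosed_closedBall.measurableSet, Metric.isBounded_closedBall,
    Metric.isClosed_closedBall.measurableSet, Metric.isBounded_closedBall]

/-- A real measure is the difference of two measures that are finite on bounded sets. -/
theorem IsSigmaAdditive.exists_measure_sub [OpensMeasurableSpace E] {C : BoundedBorel E → ℝ}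
    (hC : IsSigmaAdditive C) (o : E) :
    ∃ μ ν : Measure E, FiniteOnBounded μ ∧ FiniteOnBounded ν ∧
      ∀ A, C A = μ.real A.toSet - ν.real A.toSet := by
  -- Cut the space into the shells `n ≤ dist x o < n + 1`. A bounded set meets only finitely many of
  -- them.
  have hm : ∀ n : ℕ, MeasurableSet {x : E | ⌊dist x o⌋₊ = n} := fun n =>
    (Nat.measurable_floor.comp (continuous_id.dist continuous_const).measurable)
      (measurableSet_singleton n)
  let S : ℕ → BoundedBorel E := fun n => ⟨{x | ⌊dist x o⌋₊ = n}, hm n,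
    (Metric.isBounded_closedBall (x := o) (r := n + 1)).subset fun x hx => by
      have hx : ⌊dist x o⌋₊ = n := hx
      rw [Metric.mem_closedBall, ← hx]
      exact (Nat.lt_floor_add_one _).le⟩
  let s : ℕ → SignedMeasure E := fun n => hC.localize (S n)
  have fin : ∀ A : BoundedBorel E, ∃ N, ∀ n ∉ Finset.range N, A.toSet ∩ (S n).toSet = ∅ := by
    intro A
    obtain ⟨r, hr⟩ := A.2.2.subset_closedBall o
    refine ⟨⌊r⌋₊ + 1, fun n hn => ?_⟩
    rw [Set.eq_empty_iff_forall_notMem]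
    rintro x ⟨hx, hxn⟩
    have hxn : ⌊dist x o⌋₊ = n := hxn
    have : dist x o ≤ r := hr hx
    have := Nat.floor_le_floor this
    simp at hn
    omega
  have key : ∀ (ρ : ℕ → Measure E) [∀ n, IsFiniteMeasure (ρ n)] (A : BoundedBorel E),
      Measure.sum (fun n => (ρ n).restrict (S n).toSet) A.toSet < ∞ ∧
        HasSum (fun n => (ρ n).real (A.toSet ∩ (S n).toSet))
          ((Measure.sum (fun n => (ρ n).restrict (S n).toSet)).real A.toSet) := by
    intro ρ _ A
    obtain ⟨N, hN⟩ := fin A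
    have h0 : ∀ n ∉ Finset.range N, (ρ n) (A.toSet ∩ (S n).toSet) = 0 := fun n hn => by
      rw [hN n hn, measure_empty]
    have h1 : Measure.sum (fun n => (ρ n).restrict (S n).toSet) A.toSet =
        ∑ n ∈ Finset.range N, (ρ n) (A.toSet ∩ (S n).toSet) := by
      rw [Measure.sum_apply _ A.measurableSet]
      simp_rw [Measure.restrict_apply A.measurableSet]
      exact tsum_eq_sum h0
    refine ⟨?_, ?_⟩
    · rw [h1]
      exact ENNReal.sum_lt_top.mpr fun n _ => measure_lt_top _ _
    · rw [Measure.real, h1, ENNReal.toReal_sum fun n _ => measure_ne_top _ _]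
      exact hasSum_sum_of_ne_finset_zero fun n hn => by simp [Measure.real, h0 n hn]
  -- `C` may have infinite total variation, so the Jordan decomposition is taken shell by shell and
  -- the parts are summed.
  refine ⟨Measure.sum fun n => ((s n).toJordanDecomposition.posPart).restrict (S n).toSet,
    Measure.sum fun n => ((s n).toJordanDecomposition.negPart).restrict (S n).toSet,
    fun A => (key _ A).1, fun A => (key _ A).1, fun A => ?_⟩
  have h1 : HasSum (fun n => C (A.inter (S n))) (C A) := by
    refine hC _ _ (fun i j hij => ?_) ?_
    · refine Set.disjoint_left.mpr ?_
      rintro x ⟨_, hi⟩ ⟨_, hj⟩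
      exact hij ((show _ = _ from hi).symm.trans hj)
    · simp only [BoundedBorel.toSet_inter, ← Set.inter_iUnion]
      refine Set.inter_eq_left.mpr fun x _ => Set.mem_iUnion.mpr ⟨_, rfl⟩
  have h2 := (key (fun n => (s n).toJordanDecomposition.posPart) A).2.sub
    (key (fun n => (s n).toJordanDecomposition.negPart) A).2
  refine h1.unique (h2.congr_fun ?_)
  intro n
  rw [← SignedMeasure.apply_eq_posPart_real_sub_negPart_real _ 
    (A.measurableSet.inter (S n).measurableSet)]
  rw [show A.toSet ∩ (S n).toSet = (A.inter (S n)).toSet from rfl]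
  change _ = hC.localize (S n) _
  rw [hC.localize_toSet,
    BoundedBorel.inter_eq_left (A := A.inter (S n)) Set.inter_subset_right]

/-- The product of two real measures. -/
theorem IsSigmaAdditive.exists_prod [OpensMeasurableSpace E] [OpensMeasurableSpace F]
    {C : BoundedBorel E → ℝ} {C' : BoundedBorel F → ℝ} (hC : IsSigmaAdditive C)
    (hC' : IsSigmaAdditive C') (o : E × F) :
    ∃ K : BoundedBorel (E × F) → ℝ, IsSigmaAdditive K ∧
      ∀ A B, K (A.prod B) = C A * C' B := by
  obtain ⟨μ, ν, hμ, hν, h⟩ := hC.exists_measure_sub o.1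
  obtain ⟨μ', ν', hμ', hν', h'⟩ := hC'.exists_measure_sub o.2
  have := hμ.sigmaFinite o.1
  have := hν.sigmaFinite o.1
  have := hμ'.sigmaFinite o.2
  have := hν'.sigmaFinite o.2
  -- Expansion of `(μ - ν) × (μ' - ν')` into four products of positive measures.
  refine ⟨_, (((hμ.prod hμ' o).isSigmaAdditive.add (hν.prod hν' o).isSigmaAdditive).sub
    (hμ.prod hν' o).isSigmaAdditive).sub (hν.prod hμ' o).isSigmaAdditive, fun A B => ?_⟩
  simp only [BoundedBorel.toSet_prod, measureReal_prod_prod, h, h']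
  ring

end Real

/-! ### Fourth moments of Gaussian vectors -/

section Gaussian

variable {Ω : Type*} [MeasurableSpace Ω] {P : Measure Ω}

open scoped NNReal in
-- The fourth moment is the fourth derivative of the moment generating function at `0`. Each
-- derivative is the same exponential times a polynomial in `m + v * t`.
theorem integral_pow_four_gaussianReal (m : ℝ) (v : ℝ≥0) :
    ∫ x, x ^ 4 ∂(gaussianReal m v) = m ^ 4 + 6 * m ^ 2 * v + 3 * (v : ℝ) ^ 2 := by
  have h : ∫ x, x ^ 4 ∂(gaussianReal m v) =
      iteratedDeriv 4 (mgf (fun x ↦ x) (gaussianReal m v)) 0 := by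
    rw [iteratedDeriv_mgf_zero] <;> simp
  rw [h, mgf_fun_id_gaussianReal]
  have hexp : ∀ t : ℝ, HasDerivAt (fun t : ℝ => Real.exp (m * t + v * t ^ 2 / 2))
      (Real.exp (m * t + v * t ^ 2 / 2) * (m + v * t)) t := by
    intro t
    have := (((hasDerivAt_id' t).const_mul m).fun_add
      ((((hasDerivAt_id' t).fun_pow 2).const_mul (v : ℝ)).div_const 2)).exp
    convert this using 1
    push_cast
    ring
  have hlin : ∀ t : ℝ, HasDerivAt (fun t : ℝ => m + v * t) (v : ℝ) t := by
    intro t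
    simpa using ((hasDerivAt_id t).const_mul (v : ℝ)).const_add m
  have d1 : deriv (fun t : ℝ => Real.exp (m * t + v * t ^ 2 / 2)) =
      fun t => Real.exp (m * t + v * t ^ 2 / 2) * (m + v * t) :=
    funext fun t => (hexp t).deriv
  have d2 : deriv (fun t : ℝ => Real.exp (m * t + v * t ^ 2 / 2) * (m + v * t)) =
      fun t => Real.exp (m * t + v * t ^ 2 / 2) * ((m + v * t) ^ 2 + v) := by
    funext t
    rw [((hexp t).fun_mul (hlin t)).deriv]
    ring
  have d3 : deriv (fun t : ℝ => Real.exp (m * t + v * t ^ 2 / 2) * ((m + v * t) ^ 2 + v)) =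
      fun t => Real.exp (m * t + v * t ^ 2 / 2) * ((m + v * t) ^ 3 + 3 * v * (m + v * t)) := by
    funext t
    rw [((hexp t).fun_mul (((hlin t).fun_pow 2).add_const (v : ℝ))).deriv]
    push_cast
    ring
  have d4 : deriv (fun t : ℝ => Real.exp (m * t + v * t ^ 2 / 2) *
      ((m + v * t) ^ 3 + 3 * v * (m + v * t))) 0 = m ^ 4 + 6 * m ^ 2 * v + 3 * (v : ℝ) ^ 2 := by
    rw [((hexp 0).fun_mul (((hlin 0).fun_pow 3).fun_add ((hlin 0).const_mul (3 * (v : ℝ))))).deriv]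
    simp
    ring
  simp only [iteratedDeriv_succ, iteratedDeriv_zero, d1, d2, d3, d4]

theorem integral_pow_four_of_hasGaussianLaw {X : Ω → ℝ} (hX : HasGaussianLaw X P) :
    ∫ ω, X ω ^ 4 ∂P = P[X] ^ 4 + 6 * P[X] ^ 2 * Var[X; P] + 3 * Var[X; P] ^ 2 := by
  have h : ∫ ω, X ω ^ 4 ∂P = ∫ x, x ^ 4 ∂(P.map X) := by
    rw [integral_map hX.aemeasurable (by fun_prop)]
  rw [h, hX.map_eq_gaussianReal, integral_pow_four_gaussianReal,
    Real.coe_toNNReal _ (variance_nonneg _ _)]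

/-- Isserlis' formula for the mixed moment of four jointly Gaussian variables, not necessarily
centred, in terms of means `m i` and second moments `k i j`. -/
theorem integral_mul_four_of_hasGaussianLaw [IsProbabilityMeasure P] {X : Fin 4 → Ω → ℝ}
    (hX : HasGaussianLaw (fun ω i => X i ω) P) {k : Fin 4 → Fin 4 → ℝ} {m : Fin 4 → ℝ}
    (hm : ∀ i, m i = ∫ ω, X i ω ∂P) (hk : ∀ i j, k i j = ∫ ω, X i ω * X j ω ∂P) :
    ∫ ω, X 0 ω * X 1 ω * X 2 ω * X 3 ω ∂P =
      k 0 2 * k 1 3 + k 0 1 * k 2 3 + k 0 3 * k 2 1 - 2 * (m 0 * m 1 * (m 2 * m 3)) := by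
  have hlaw : ∀ i, HasGaussianLaw (X i) P := fun i => hX.eval i
  have hmem : ∀ i, MemLp (X i) 2 P := fun i => (hlaw i).memLp (by norm_num)
  have hint : ∀ i, Integrable (X i) P := fun i => (hlaw i).integrable
  have hint2 : ∀ i j, Integrable (fun ω => X i ω * X j ω) P :=
    fun i j => (hmem i).integrable_mul (hmem j)
  have hsymm : ∀ i j, k i j = k j i := fun i j => by simp only [hk, mul_comm]
  have hcomb : ∀ a : Fin 4 → ℝ, HasGaussianLaw (fun ω => ∑ i, a i * X i ω) P := fun a => by
    have := hX.map_fun (∑ i, a i • ContinuousLinearMap.proj (R := ℝ) (φ := fun _ : Fin 4 => ℝ) i)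
    simpa using this
  have hmean : ∀ a : Fin 4 → ℝ, ∫ ω, ∑ i, a i * X i ω ∂P = ∑ i, a i * m i := fun a => by
    rw [integral_finsetSum _ fun i _ => (hint i).const_mul _]
    simp only [integral_const_mul, hm]
  have hsq : ∀ a : Fin 4 → ℝ, ∫ ω, (∑ i, a i * X i ω) ^ 2 ∂P =
      ∑ i, ∑ j, a i * a j * k i j := fun a => by
    have : ∀ ω, (∑ i, a i * X i ω) ^ 2 = ∑ i, ∑ j, a i * a j * (X i ω * X j ω) := fun ω => by
      rw [sq, Finset.sum_mul_sum]
      exact Finset.sum_congr rfl fun i _ => Finset.sum_congr rfl fun j _ => by ring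
    simp only [this]
    rw [integral_finsetSum _ fun i _ => integrable_finsetSum _ fun j _ => (hint2 i j).const_mul _]
    refine Finset.sum_congr rfl fun i _ => ?_
    rw [integral_finsetSum _ fun j _ => (hint2 i j).const_mul _]
    simp only [integral_const_mul, hk]
  -- With mean `m` and second moment `s = v + m²`, the fourth moment `m⁴ + 6m²v + 3v²` equals `3s² -
  -- 2m⁴`.
  have h4 : ∀ a : Fin 4 → ℝ, ∫ ω, (∑ i, a i * X i ω) ^ 4 ∂P =
      3 * (∑ i, ∑ j, a i * a j * k i j) ^ 2 - 2 * (∑ i, a i * m i) ^ 4 := fun a => by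
    rw [integral_pow_four_of_hasGaussianLaw (hcomb a),
      variance_eq_sub ((hcomb a).memLp (by norm_num))]
    simp only [Pi.pow_apply, hmean, hsq]
    ring
  have hint4 : ∀ a : Fin 4 → ℝ, Integrable (fun ω => (∑ i, a i * X i ω) ^ 4) P := fun a => by
    have := ((hcomb a).memLp (p := 4) (by norm_num)).integrable_norm_pow (by norm_num)
    refine this.congr (ae_of_all _ fun ω => ?_)
    simp only [Real.norm_eq_abs]
    exact (show Even 4 by decide).pow_abs _
  -- Polarization: sum `(x₀ ± x₁ ± x₂ ± x₃)⁴` over the eight sign choices, weighted by the product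
  -- `c` of the signs. Only the monomial `x₀x₁x₂x₃` survives, with coefficient `8 * 24 = 192`.
  let a : Fin 8 → Fin 4 → ℝ := ![![1, 1, 1, 1], ![1, 1, -1, -1], ![1, -1, 1, -1], ![1, -1, -1, 1],
    ![1, 1, 1, -1], ![1, 1, -1, 1], ![1, -1, 1, 1], ![1, -1, -1, -1]]
  let c : Fin 8 → ℝ := ![1, 1, 1, 1, -1, -1, -1, -1]
  have hpol : ∀ ω, X 0 ω * X 1 ω * X 2 ω * X 3 ω =
      ∑ l, c l / 192 * (∑ i, a l i * X i ω) ^ 4 := by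
    intro ω
    simp only [a, c, Fin.sum_univ_eight, Fin.sum_univ_four]
    simp
    ring
  simp only [hpol]
  rw [integral_finsetSum _ fun l _ => (hint4 (a l)).const_mul _]
  simp only [integral_const_mul, h4]
  simp only [a, c, Fin.sum_univ_eight, Fin.sum_univ_four]
  simp [hsymm 1 0, hsymm 2 0, hsymm 3 0, hsymm 2 1, hsymm 3 1, hsymm 3 2]
  ring

end Gaussian

/-! ### Extension of a measure with values in a Hilbert space -/

section Gram

/-- Used twice: with preimages under the two projections, for a quadratic form on a product space,
and with `B = C`, for the squared `L²` norm of a simple function. -/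
theorem sum_sum_measureReal_inter {α ι : Type*} [MeasurableSpace α] (ρ : Measure α)
    [IsFiniteMeasure ρ] [Fintype ι] (a : ι → ℝ) {B C : ι → Set α}
    (hB : ∀ i, MeasurableSet (B i)) (hC : ∀ i, MeasurableSet (C i)) :
    ∑ i, ∑ j, a i * a j * ρ.real (B i ∩ C j) =
      ∫ x, (∑ i, (B i).indicator (fun _ => a i) x) *
        (∑ j, (C j).indicator (fun _ => a j) x) ∂ρ := by
  have h : ∀ x, (∑ i, (B i).indicator (fun _ => a i) x) * (∑ j, (C j).indicator (fun _ => a j) x) =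
      ∑ i, ∑ j, (B i ∩ C j).indicator (fun _ => a i * a j) x := fun x => by
    rw [Finset.sum_mul_sum]
    simp only [Set.inter_indicator_mul]
  have hi : ∀ i j, Integrable ((B i ∩ C j).indicator (fun _ => a i * a j)) ρ := fun i j =>
    (integrable_const _).indicator ((hB i).inter (hC j))
  simp only [h]
  rw [integral_finsetSum _ fun i _ => integrable_finsetSum _ fun j _ => hi i j]
  refine Finset.sum_congr rfl fun i _ => ?_
  rw [integral_finsetSum _ fun j _ => hi i j]
  refine Finset.sum_congr rfl fun j _ => ?_
  rw [integral_indicator_const _ ((hB i).inter (hC j)), smul_eq_mul, mul_comm]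

/-- A quadratic form given by a finite measure on `E × E` is bounded by the `L²` norm of the sum
of the two marginals. -/
theorem abs_sum_sum_measureReal_prod_le {E ι : Type*} [MeasurableSpace E] (ρ : Measure (E × E))
    [IsFiniteMeasure ρ] [Fintype ι] (a : ι → ℝ) {A : ι → Set E} (hA : ∀ i, MeasurableSet (A i)) :
    |∑ i, ∑ j, a i * a j * ρ.real (A i ×ˢ A j)| ≤
      ∫ x, (∑ i, (A i).indicator (fun _ => a i) x) ^ 2 ∂(ρ.fst + ρ.snd) := by
  set f : E → ℝ := fun x => ∑ i, (A i).indicator (fun _ => a i) x with hf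
  have hfm : Measurable f :=
    Finset.measurable_fun_sum _ fun i _ => measurable_const.indicator (hA i)
  have hfb : ∀ x, ‖f x‖ ≤ ∑ i, ‖a i‖ := fun x =>
    (norm_sum_le _ _).trans (Finset.sum_le_sum fun i _ => norm_indicator_le_norm_self _ _)
  have hfi : ∀ (κ : Measure E) [IsFiniteMeasure κ], Integrable (fun x => f x ^ 2) κ := fun κ _ => by
    refine Integrable.of_bound (hfm.pow_const 2).aestronglyMeasurable ((∑ i, ‖a i‖) ^ 2)
      (ae_of_all _ fun x => ?_)
    rw [norm_pow]
    gcongr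
    exact hfb x
  have h1 : ∑ i, ∑ j, a i * a j * ρ.real (A i ×ˢ A j) = ∫ z, f z.1 * f z.2 ∂ρ := by
    have := sum_sum_measureReal_inter ρ a (fun i => measurable_fst (hA i))
      (fun i => measurable_snd (hA i))
    simp only [← Set.prod_eq] at this
    rw [this]
    rfl
  have hi1 : Integrable (fun z : E × E => f z.1 ^ 2) ρ :=
    (hfi ρ.fst).comp_measurable measurable_fst
  have hi2 : Integrable (fun z : E × E => f z.2 ^ 2) ρ :=
    (hfi ρ.snd).comp_measurable measurable_snd
  have h2 : ∫ x, f x ^ 2 ∂(ρ.fst + ρ.snd) = ∫ z, (f z.1 ^ 2 + f z.2 ^ 2) ∂ρ := by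
    rw [integral_add_measure (hfi _) (hfi _), integral_add hi1 hi2, Measure.fst, Measure.snd,
      integral_map measurable_fst.aemeasurable (hfm.pow_const 2).aestronglyMeasurable,
      integral_map measurable_snd.aemeasurable (hfm.pow_const 2).aestronglyMeasurable]
  rw [h1, h2]
  -- Pointwise, `|f(z₁) f(z₂)| ≤ f(z₁)² + f(z₂)²`.
  refine abs_integral_le_integral_abs.trans ?_
  refine integral_mono_of_nonneg (ae_of_all _ fun z => abs_nonneg _) (hi1.add hi2)
    (ae_of_all _ fun z => ?_)
  simp only [abs_le]
  constructor <;> nlinarith [sq_nonneg (f z.1 + f z.2), sq_nonneg (f z.1 - f z.2),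
    sq_nonneg (f z.1), sq_nonneg (f z.2)]

variable {E : Type*} [MeasurableSpace E] [PseudoMetricSpace E]

universe w in
/-- The quadratic form of a real measure on `E × E` is bounded, on the simple functions supported
in a bounded set, by the `L²` norm of a finite measure. -/
theorem IsSigmaAdditive.exists_dominating [OpensMeasurableSpace E] [SecondCountableTopology E]
    {G : BoundedBorel (E × E) → ℝ}
    (hG : IsSigmaAdditive G) (o : E) (D : BoundedBorel E) :
    ∃ ν : Measure E, IsFiniteMeasure ν ∧ ∀ (ι : Type w) [Fintype ι] (a : ι → ℝ)
      (A : ι → BoundedBorel E), (∀ i, (A i).toSet ⊆ D.toSet) →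
      ∑ i, ∑ j, a i * a j * G ((A i).prod (A j)) ≤
        ∫ x, (∑ i, (A i).toSet.indicator (fun _ => a i) x) ^ 2 ∂ν := by
  obtain ⟨μ, μ', hμ, hμ', h⟩ := hG.exists_measure_sub (o, o)
  set DD := (D.prod D).toSet with hDD
  have h1 : IsFiniteMeasure (μ.restrict DD) := ⟨by
    rw [Measure.restrict_apply_univ]; exact hμ (D.prod D)⟩
  have h2 : IsFiniteMeasure (μ'.restrict DD) := ⟨by
    rw [Measure.restrict_apply_univ]; exact hμ' (D.prod D)⟩
  -- All four marginals are added, so that the form of `μ` is bounded above and that of `μ'` below.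
  -- An upper bound alone suffices, as the form will be a squared norm.
  refine ⟨((μ.restrict DD).fst + (μ.restrict DD).snd) +
    ((μ'.restrict DD).fst + (μ'.restrict DD).snd), inferInstance, fun ι _ a A hA => ?_⟩
  have hsub : ∀ i j, (A i).toSet ×ˢ (A j).toSet ⊆ DD := fun i j => Set.prod_mono (hA i) (hA j)
  have hm : ∀ i j, MeasurableSet ((A i).toSet ×ˢ (A j).toSet) := fun i j =>
    (A i).measurableSet.prod (A j).measurableSet
  have hr : ∀ (κ : Measure (E × E)) i j, κ.real ((A i).toSet ×ˢ (A j).toSet) =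
      (κ.restrict DD).real ((A i).toSet ×ˢ (A j).toSet) := fun κ i j => by
    rw [measureReal_restrict_apply (hm i j), Set.inter_eq_left.mpr (hsub i j)]
  have hi : ∀ (κ : Measure E) [IsFiniteMeasure κ],
      Integrable (fun x => (∑ i, (A i).toSet.indicator (fun _ => a i) x) ^ 2) κ := fun κ _ => by
    refine Integrable.of_bound (Measurable.aestronglyMeasurable ?_) ((∑ i, ‖a i‖) ^ 2)
      (ae_of_all _ fun x => ?_)
    · exact (Finset.measurable_fun_sum _ fun i _ =>
        measurable_const.indicator (A i).measurableSet).pow_const 2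
    · rw [norm_pow]
      gcongr
      exact (norm_sum_le _ _).trans
        (Finset.sum_le_sum fun i _ => norm_indicator_le_norm_self _ _)
  rw [integral_add_measure (hi _) (hi _)]
  have e : ∑ i, ∑ j, a i * a j * G ((A i).prod (A j)) =
      ∑ i, ∑ j, a i * a j * (μ.restrict DD).real ((A i).toSet ×ˢ (A j).toSet) -
        ∑ i, ∑ j, a i * a j * (μ'.restrict DD).real ((A i).toSet ×ˢ (A j).toSet) := by
    simp only [← hr, ← Finset.sum_sub_distrib, h, BoundedBorel.toSet_prod, mul_sub]
  rw [e]
  have b1 := abs_sum_sum_measureReal_prod_le (μ.restrict DD) a fun i => (A i).measurableSet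
  have b2 := abs_sum_sum_measureReal_prod_le (μ'.restrict DD) a fun i => (A i).measurableSet
  linarith [(abs_le.mp b1).2, (abs_le.mp b2).1]

/-- The sums run over the subtype `c.support` to match the finite index types of
`IsSigmaAdditive.exists_dominating`. -/
theorem norm_linearCombination_sq {ι K : Type*} [NormedAddCommGroup K] [InnerProductSpace ℝ K]
    (g : ι → K) (c : ι →₀ ℝ) : ‖Finsupp.linearCombination ℝ g c‖ ^ 2 =
      ∑ i : c.support, ∑ j : c.support, c i * c j * inner ℝ (g i) (g j) := by
  have : Finsupp.linearCombination ℝ g c = ∑ i : c.support, c i • g i := by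
    rw [Finsupp.linearCombination_apply, Finsupp.sum, ← Finset.sum_coe_sort]
  rw [this, ← real_inner_self_eq_norm_sq, sum_inner]
  refine Finset.sum_congr rfl fun i _ => ?_
  rw [inner_sum]
  refine Finset.sum_congr rfl fun j _ => ?_
  rw [real_inner_smul_left, real_inner_smul_right, mul_assoc]

/-- A map between families of vectors that decreases the norm of linear combinations is the
restriction of a continuous linear map. -/
theorem exists_clm_of_norm_le {ι H K : Type*} [NormedAddCommGroup K] [InnerProductSpace ℝ K]
    [CompleteSpace K] [NormedAddCommGroup H] [NormedSpace ℝ H] [CompleteSpace H]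
    (f : ι → K) (e : ι → H)
    (h : ∀ c : ι →₀ ℝ, ‖Finsupp.linearCombination ℝ e c‖ ≤ ‖Finsupp.linearCombination ℝ f c‖) :
    ∃ L : K →L[ℝ] H, ∀ i, L (f i) = e i := by
  -- The norm inequality makes `f i ↦ e i` well defined and contractive on the span. It extends to
  -- the closure `S` by density and to all of `K` by the orthogonal projection onto `S`.
  let S := (LinearMap.range (Finsupp.linearCombination ℝ f)).topologicalClosure
  have hS : ∀ c, Finsupp.linearCombination ℝ f c ∈ S := fun c =>
    Submodule.le_topologicalClosure _ ⟨c, rfl⟩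
  let Φ : (ι →₀ ℝ) →ₗ[ℝ] S := (Finsupp.linearCombination ℝ f).codRestrict S hS
  have hd : DenseRange Φ := by
    rw [DenseRange, Subtype.dense_iff]
    intro x hx
    have h' : Set.range (Finsupp.linearCombination ℝ f) ⊆ Subtype.val '' Set.range Φ := by
      rintro _ ⟨c, rfl⟩
      exact ⟨Φ c, ⟨c, rfl⟩, rfl⟩
    exact closure_mono h' hx
  have : CompleteSpace S :=
    (Submodule.isClosed_topologicalClosure _).completeSpace_coe
  refine ⟨((Finsupp.linearCombination ℝ e).extendOfNorm Φ) ∘L S.orthogonalProjectionOnto,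
    fun i => ?_⟩
  have hf : f i = (Φ (Finsupp.single i 1) : K) := by simp [Φ]
  rw [ContinuousLinearMap.comp_apply, hf, Submodule.orthogonalProjectionOnto_mem_subspace_eq_self,
    LinearMap.extendOfNorm_eq hd ⟨1, fun c => (h c).trans (one_mul _).ge⟩]
  simp

/-- The `L²`-valued set function `U ↦ 𝟙_U` is `σ`-additive. -/
theorem isSigmaAdditive_indicatorConstLp (ν : Measure E) [IsFiniteMeasure ν] :
    IsSigmaAdditive (fun U : BoundedBorel E =>
      indicatorConstLp 2 (μ := ν) U.measurableSet (measure_ne_top _ _) (1 : ℝ)) := by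
  classical
  intro A B hd hB
  have hm : ∀ s : Finset ℕ, MeasurableSet (⋃ i ∈ s, (A i).toSet) := fun s =>
    s.measurableSet_biUnion fun i _ => (A i).measurableSet
  have hsum : ∀ s : Finset ℕ, ∑ i ∈ s, indicatorConstLp 2 (μ := ν) (A i).measurableSet
      (measure_ne_top _ _) (1 : ℝ) = indicatorConstLp 2 (hm s) (measure_ne_top _ _) 1 := by
    intro s
    induction s using Finset.induction_on with
    | empty => simp
    | insert i s hi ih =>
      rw [Finset.sum_insert hi, ih, ← indicatorConstLp_disjoint_union]
      · simp
      · simp only [Set.disjoint_iUnion_right]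
        exact fun j hj => hd fun hij => hi (hij ▸ hj)
  simp only [HasSum, SummationFilter.unconditional_filter]
  rw [show (fun s : Finset ℕ => ∑ i ∈ s, indicatorConstLp 2 (μ := ν) (A i).measurableSet
      (measure_ne_top _ _) (1 : ℝ)) = _ from funext hsum]
  refine tendsto_indicatorConstLp_set (by norm_num) ?_
  -- Convergence in `L²` of indicators amounts to the measure of the symmetric difference, here the
  -- mass of the missing sets, tending to zero.
  have hs : ∀ s : Finset ℕ, ν (symmDiff (⋃ i ∈ s, (A i).toSet) B.toSet) =
      ν B.toSet - ∑ i ∈ s, ν (A i).toSet := by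
    intro s
    have hsub : (⋃ i ∈ s, (A i).toSet) ⊆ B.toSet := by
      rw [← hB]
      exact Set.iUnion₂_subset fun i _ => Set.subset_iUnion (fun i => (A i).toSet) i
    rw [symmDiff_of_le hsub, measure_sdiff hsub (hm s).nullMeasurableSet (measure_ne_top _ _),
      measure_biUnion_finset (fun i _ j _ hij => hd hij) fun i _ => (A i).measurableSet]
  simp only [hs]
  have ht : HasSum (fun i => ν (A i).toSet) (ν B.toSet) := by
    rw [← hB, measure_iUnion hd fun n => (A n).measurableSet]
    exact ENNReal.summable.hasSum
  have := ENNReal.Tendsto.sub (tendsto_const_nhds (x := ν B.toSet)) ht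
    (Or.inl (measure_ne_top _ _))
  simpa using this

/-- A family of vectors whose Gram matrix is given by a real measure, on sets that lie in a bounded
set, extends to a `σ`-additive set function. -/
theorem exists_isSigmaAdditive_of_gram [OpensMeasurableSpace E] [SecondCountableTopology E]
    {ι H : Type*} [NormedAddCommGroup H] [InnerProductSpace ℝ H] [CompleteSpace H]
    {G : BoundedBorel (E × E) → ℝ} (hG : IsSigmaAdditive G) (o : E) (D : BoundedBorel E)
    (R : ι → BoundedBorel E) (e : ι → H)
    (hR : ∀ i, (R i).toSet ⊆ D.toSet)
    (hRe : ∀ i j, inner ℝ (e i) (e j) = G ((R i).prod (R j))) :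
    ∃ T : BoundedBorel E → H, IsSigmaAdditive T ∧ ∀ i, T (R i) = e i := by
  obtain ⟨ν, hν, h⟩ := hG.exists_dominating o D
  let f : ι → Lp ℝ 2 ν := fun i =>
    indicatorConstLp 2 (μ := ν) (R i).measurableSet (measure_ne_top _ _) (1 : ℝ)
  obtain ⟨L, hL⟩ := exists_clm_of_norm_le f e fun c => by
    refine (sq_le_sq₀ (norm_nonneg _) (norm_nonneg _)).mp ?_
    rw [norm_linearCombination_sq, norm_linearCombination_sq]
    simp only [hRe, f, L2.real_inner_indicatorConstLp_one_indicatorConstLp_one]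
    rw [sum_sum_measureReal_inter ν (fun i : c.support => c i)
      (fun i => (R i).measurableSet) (fun i => (R i).measurableSet)]
    simp only [← sq]
    exact h c.support (fun i => c i) (fun i => R i) fun i => hR i
  exact ⟨_, (isSigmaAdditive_indicatorConstLp ν).map_clm L, fun i => hL i⟩

end Gram

/-! ### Construction of the tensor product -/

section Tensor

/-- Carries the product of the second-moment measures of `M₁` and `M₂` to `(E × F) × (E × F)`. Being
an isometry for the sup metric, the map pulls bounded sets back to bounded sets. -/
theorem isometry_prodProdProdComm {E F : Type*} [PseudoMetricSpace E] [PseudoMetricSpace F] :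
    Isometry (fun z : (E × E) × (F × F) => ((z.1.1, z.2.1), (z.1.2, z.2.2))) :=
  Isometry.of_dist_eq fun x y => by
    simp only [Prod.dist_eq]
    exact max_max_max_comm _ _ _ _

/-- Exchanging the second coordinates produces the crossed Isserlis term, which pairs `A` with `B'`
and `A'` with `B`. -/
theorem isometry_prodSwapSnd {E F : Type*} [PseudoMetricSpace E] [PseudoMetricSpace F] :
    Isometry (fun z : (E × F) × (E × F) => ((z.1.1, z.2.2), (z.2.1, z.1.2))) :=
  Isometry.of_dist_eq fun x y => by
    simp only [Prod.dist_eq]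
    rw [max_max_max_comm, max_comm (dist x.2.2 y.2.2), max_max_max_comm]

variable {E F : Type*} [MeasurableSpace E] [PseudoMetricSpace E] [MeasurableSpace F]
  [PseudoMetricSpace F]

theorem IsSigmaAdditive.comp_inter {V : Type*} [AddCommMonoid V] [TopologicalSpace V]
    {m : BoundedBorel E → V} (hm : IsSigmaAdditive m) (D : BoundedBorel E) :
    IsSigmaAdditive (fun U => m (U.inter D)) := by
  intro A B hd hB
  refine hm _ _ (fun i j hij => ?_) ?_
  · exact (hd hij).mono Set.inter_subset_left Set.inter_subset_left
  · simp only [BoundedBorel.toSet_inter, ← hB, Set.iUnion_inter]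

/-- The closed balls as bounded Borel sets. -/
def BoundedBorel.closedBall [OpensMeasurableSpace E] (o : E) (r : ℝ) : BoundedBorel E :=
  ⟨Metric.closedBall o r, Metric.isClosed_closedBall.measurableSet, Metric.isBounded_closedBall⟩

variable {Ω : Type*} [MeasurableSpace Ω] {P : Measure Ω}

theorem inner_eq_integral_mul (X Y : Lp ℝ 2 P) : inner ℝ X Y = ∫ ω, X ω * Y ω ∂P := by
  rw [L2.inner_def]
  simp only [RCLike.inner_apply, conj_trivial, mul_comm]

variable [OpensMeasurableSpace E] [OpensMeasurableSpace F]

theorem IsTensorRandomMeasure.unique {M₁ : BoundedBorel E → Lp ℝ 2 P}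
    {M₂ : BoundedBorel F → Lp ℝ 2 P} {T T' : BoundedBorel (E × F) → Lp ℝ 2 P}
    (hT : IsTensorRandomMeasure P M₁ M₂ T) (hT' : IsTensorRandomMeasure P M₁ M₂ T') (o : E × F) :
    T' = T :=
  hT'.isRandomMeasure.sigmaAdditive.ext_prod hT.isRandomMeasure.sigmaAdditive (fun A B => by
    refine Lp.ext ?_
    filter_upwards [hT.apply_prod A B, hT'.apply_prod A B] with ω h h'
    rw [h, h']) o

variable [IsProbabilityMeasure P]

theorem cov_eq_inner_sub (X Y : Lp ℝ 2 P) :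
    cov[X, Y; P] = inner ℝ X Y - (∫ ω, X ω ∂P) * ∫ ω, Y ω ∂P := by
  rw [covariance_eq_sub (Lp.memLp X) (Lp.memLp Y), inner_eq_integral_mul]
  rfl

/-- The mean is the inner product with the constant `1`, a continuous linear functional on `L²(P)`.
-/
theorem IsSigmaAdditive.integral {E : Type*} [MeasurableSpace E] [PseudoMetricSpace E]
    {M : BoundedBorel E → Lp ℝ 2 P} (hM : IsSigmaAdditive M) :
    IsSigmaAdditive (fun A => ∫ ω, M A ω ∂P) := by
  have := hM.map_clm (innerSL ℝ
    (indicatorConstLp 2 (μ := P) MeasurableSet.univ (measure_ne_top _ _) (1 : ℝ)))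
  simpa only [innerSL_apply_apply, L2.inner_indicatorConstLp_one, setIntegral_univ] using this

/-- The second moments of two `L²`-valued measures are given by a real measure if their covariances
are. -/
theorem exists_secondMoment_of_covariance {M₁ : BoundedBorel E → Lp ℝ 2 P}
    {M₂ : BoundedBorel F → Lp ℝ 2 P} (hM₁ : IsSigmaAdditive M₁) (hM₂ : IsSigmaAdditive M₂)
    (hC : HasCrossCovarianceMeasure P M₁ M₂) (o : E × F) :
    ∃ K : BoundedBorel (E × F) → ℝ, IsSigmaAdditive K ∧
      ∀ A B, K (A.prod B) = inner ℝ (M₁ A) (M₂ B) := by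
  obtain ⟨C, hC, h⟩ := hC
  obtain ⟨K, hK, h'⟩ := hM₁.integral.exists_prod hM₂.integral o
  refine ⟨_, hC.add hK, fun A B => ?_⟩
  rw [h, h', cov_eq_inner_sub]
  ring

theorem IsRandomMeasure.exists_secondMoment {M : BoundedBorel E → Lp ℝ 2 P}
    (hM : IsRandomMeasure P M) (o : E) :
    ∃ K : BoundedBorel (E × E) → ℝ, IsSigmaAdditive K ∧
      ∀ A B, K (A.prod B) = inner ℝ (M A) (M B) :=
  exists_secondMoment_of_covariance hM.sigmaAdditive hM.sigmaAdditive hM.exists_covariance (o, o)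

theorem IsRandomMeasure.of_secondMoment {M : BoundedBorel E → Lp ℝ 2 P}
    (hM : IsSigmaAdditive M) (o : E) {K : BoundedBorel (E × E) → ℝ} (hK : IsSigmaAdditive K)
    (h : ∀ A B, inner ℝ (M A) (M B) = K (A.prod B)) : IsRandomMeasure P M where
  sigmaAdditive := hM
  exists_covariance := by
    obtain ⟨K', hK', h'⟩ := hM.integral.exists_prod hM.integral (o, o)
    refine ⟨_, hK.sub hK', fun A B => ?_⟩
    rw [cov_eq_inner_sub, h, h']

variable [SecondCountableTopology E] [SecondCountableTopology F]

/-- A family of vectors indexed by rectangles, whose Gram matrix is given by a real measure, extends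
to a `σ`-additive set function with the same Gram matrix. -/
theorem exists_isSigmaAdditive_of_gram_prod {H : Type*} [NormedAddCommGroup H]
    [InnerProductSpace ℝ H] [CompleteSpace H] {G : BoundedBorel ((E × F) × (E × F)) → ℝ}
    (hG : IsSigmaAdditive G) (o : E × F) (e : BoundedBorel E → BoundedBorel F → H)
    (he : ∀ A B A' B', inner ℝ (e A B) (e A' B') = G ((A.prod B).prod (A'.prod B'))) :
    ∃ T : BoundedBorel (E × F) → H, IsSigmaAdditive T ∧ (∀ A B, T (A.prod B) = e A B) ∧
      ∀ U V, inner ℝ (T U) (T V) = G (U.prod V) := by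
  -- The dominating measure depends on a bounded set, so the extension is built on an exhausting
  -- sequence of rectangles and glued.
  let D₁ : ℕ → BoundedBorel E := fun n => BoundedBorel.closedBall o.1 n
  let D₂ : ℕ → BoundedBorel F := fun n => BoundedBorel.closedBall o.2 n
  have hD₁ : ∀ {n k}, n ≤ k → (D₁ n).toSet ⊆ (D₁ k).toSet := fun h =>
    Metric.closedBall_subset_closedBall (Nat.cast_le.mpr h)
  have hD₂ : ∀ {n k}, n ≤ k → (D₂ n).toSet ⊆ (D₂ k).toSet := fun h =>
    Metric.closedBall_subset_closedBall (Nat.cast_le.mpr h)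
  have hloc : ∀ n : ℕ, ∃ T : BoundedBorel (E × F) → H, IsSigmaAdditive T ∧
      ∀ A B, (A.toSet ⊆ (D₁ n).toSet) → (B.toSet ⊆ (D₂ n).toSet) → T (A.prod B) = e A B := by
    intro n
    let ι := {i : BoundedBorel E × BoundedBorel F //
      i.1.toSet ⊆ (D₁ n).toSet ∧ i.2.toSet ⊆ (D₂ n).toSet}
    obtain ⟨T, hT, hTe⟩ := exists_isSigmaAdditive_of_gram hG o ((D₁ n).prod (D₂ n))
      (fun i : ι => i.1.1.prod i.1.2) (fun i : ι => e i.1.1 i.1.2)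
      (fun i => Set.prod_mono i.2.1 i.2.2) (fun i j => he _ _ _ _)
    exact ⟨T, hT, fun A B hA hB => hTe ⟨(A, B), hA, hB⟩⟩
  choose T hT hTe using hloc
  have hcompat : ∀ n k, n ≤ k → ∀ U : BoundedBorel (E × F),
      U.toSet ⊆ ((D₁ n).prod (D₂ n)).toSet → T k U = T n U := by
    intro n k hnk U hU
    have := ((hT k).comp_inter ((D₁ n).prod (D₂ n))).ext_prod
      ((hT n).comp_inter ((D₁ n).prod (D₂ n))) (fun A B => ?_) o
    · simpa only [BoundedBorel.inter_eq_left hU] using congrFun this U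
    · rw [BoundedBorel.prod_inter_prod, hTe n _ _ Set.inter_subset_right Set.inter_subset_right,
        hTe k _ _ (Set.inter_subset_right.trans (hD₁ hnk))
          (Set.inter_subset_right.trans (hD₂ hnk))]
  have hcover : ∀ U : BoundedBorel (E × F), ∃ n, U.toSet ⊆ ((D₁ n).prod (D₂ n)).toSet := by
    intro U
    obtain ⟨r, hr⟩ := U.isBounded.subset_closedBall o
    obtain ⟨n, hn⟩ := exists_nat_ge r
    refine ⟨n, hr.trans ?_⟩
    rw [← closedBall_prod_same]
    exact Set.prod_mono (Metric.closedBall_subset_closedBall hn)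
      (Metric.closedBall_subset_closedBall hn)
  choose N hN using hcover
  have hN' : ∀ U n, U.toSet ⊆ ((D₁ n).prod (D₂ n)).toSet → T (N U) U = T n U := by
    intro U n hU
    rw [← hcompat _ _ (le_max_left (N U) n) U (hN U), hcompat _ _ (le_max_right (N U) n) U hU]
  have hσ : IsSigmaAdditive (fun U => T (N U) U) := by
    intro A B hd hB
    have hsub : ∀ n, (A n).toSet ⊆ ((D₁ (N B)).prod (D₂ (N B))).toSet := fun n =>
      (Set.subset_iUnion (fun n => (A n).toSet) n).trans (hB.subset.trans (hN B))
    simp only [fun n => hN' (A n) (N B) (hsub n)]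
    exact hT (N B) A B hd hB
  have hrect : ∀ A B, T (N (A.prod B)) (A.prod B) = e A B := by
    intro A B
    -- An empty product bounds neither factor, so `hTe` does not apply. The Gram matrix then gives
    -- `‖e A B‖² = 0`.
    rcases A.toSet.eq_empty_or_nonempty with hA | hA
    · have h0 : (A.prod B).toSet = ∅ := by simp [hA]
      rw [(hT _).apply_eq_zero h0]
      have : inner ℝ (e A B) (e A B) = 0 := by
        rw [he, hG.apply_eq_zero (by simp [hA])]
      exact (inner_self_eq_zero.mp this).symm
    rcases B.toSet.eq_empty_or_nonempty with hB | hB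
    · have h0 : (A.prod B).toSet = ∅ := by simp [hB]
      rw [(hT _).apply_eq_zero h0]
      have : inner ℝ (e A B) (e A B) = 0 := by
        rw [he, hG.apply_eq_zero (by simp [hB])]
      exact (inner_self_eq_zero.mp this).symm
    have := (Set.prod_subset_prod_iff.mp (hN (A.prod B))).resolve_right
      (by simp [hA.ne_empty, hB.ne_empty])
    exact hTe _ _ _ this.1 this.2
  refine ⟨_, hσ, hrect, fun U V => ?_⟩
  -- The Gram identity passes from rectangles to all sets one argument at a time, both sides being
  -- `σ`-additive in each argument.
  have h1 : ∀ A B U, inner ℝ (T (N U) U) (e A B) = G (U.prod (A.prod B)) := by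
    intro A B U
    have := (hσ.map_clm (innerSL ℝ (e A B))).ext_prod (hG.prod_right (A.prod B))
      (fun A' B' => ?_) o
    · have := congrFun this U
      simp only [innerSL_apply_apply] at this
      rw [real_inner_comm, this]
    · simp only [innerSL_apply_apply, hrect]
      rw [real_inner_comm, he]
  have := (hσ.map_clm (innerSL ℝ (T (N U) U))).ext_prod (hG.prod_left U)
    (fun A B => ?_) o
  · exact congrFun this V
  · simp only [innerSL_apply_apply, hrect, h1]

/-- The mixed fourth moments of jointly Gaussian random measures are given by a real measure. -/
theorem exists_fourthMoment {M₁ : BoundedBorel E → Lp ℝ 2 P}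
    {M₂ : BoundedBorel F → Lp ℝ 2 P} (hM₁ : IsRandomMeasure P M₁) (hM₂ : IsRandomMeasure P M₂)
    (hG : JointlyGaussian P M₁ M₂) (hC : HasCrossCovarianceMeasure P M₁ M₂) (o : E × F) :
    ∃ G : BoundedBorel ((E × F) × (E × F)) → ℝ, IsSigmaAdditive G ∧ ∀ A B A' B',
      ∫ ω, M₁ A ω * M₂ B ω * M₁ A' ω * M₂ B' ω ∂P = G ((A.prod B).prod (A'.prod B')) := by
  obtain ⟨K₁, hK₁, h₁⟩ := hM₁.exists_secondMoment o.1
  obtain ⟨K₂, hK₂, h₂⟩ := hM₂.exists_secondMoment o.2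
  obtain ⟨K, hK, h⟩ := exists_secondMoment_of_covariance hM₁.sigmaAdditive hM₂.sigmaAdditive hC o
  obtain ⟨N, hN, hN'⟩ := hM₁.sigmaAdditive.integral.exists_prod hM₂.sigmaAdditive.integral o
  obtain ⟨G₁, hG₁, hG₁'⟩ := hK₁.exists_prod hK₂ ((o.1, o.1), (o.2, o.2))
  obtain ⟨G₂, hG₂, hG₂'⟩ := hK.exists_prod hK (o, o)
  obtain ⟨G₃, hG₃, hG₃'⟩ := hN.exists_prod hN (o, o)
  have hb₁ : ∀ U : Set ((E × F) × (E × F)), Bornology.IsBounded U → Bornology.IsBounded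
      ((fun z : (E × E) × (F × F) => ((z.1.1, z.2.1), (z.1.2, z.2.2))) ⁻¹' U) :=
    fun U hU => isometry_prodProdProdComm.antilipschitz.isBounded_preimage hU
  have hb₂ : ∀ U : Set ((E × F) × (E × F)), Bornology.IsBounded U → Bornology.IsBounded
      ((fun z : (E × F) × (E × F) => ((z.1.1, z.2.2), (z.2.1, z.1.2))) ⁻¹' U) :=
    fun U hU => isometry_prodSwapSnd.antilipschitz.isBounded_preimage hU
  -- The three pairings of Isserlis' formula, then the product of the means subtracted twice for the
  -- factor `2`.
  refine ⟨_, ((((hG₁.comp_preimage _ (by fun_prop) hb₁).add hG₂).add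
    (hG₂.comp_preimage _ (by fun_prop) hb₂)).sub hG₃).sub hG₃, fun A B A' B' => ?_⟩
  let f : Fin 4 → BoundedBorel E ⊕ BoundedBorel F :=
    ![Sum.inl A, Sum.inr B, Sum.inl A', Sum.inr B']
  have hlaw : HasGaussianLaw (fun ω i => (Sum.elim (fun (A : BoundedBorel E) (ω : Ω) => M₁ A ω)
      (fun (B : BoundedBorel F) (ω : Ω) => M₂ B ω)) (f i) ω) P := by
    have := (hG.comp_right f).hasGaussianLaw Finset.univ
    exact this.map_fun (ContinuousLinearMap.pi fun i : Fin 4 =>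
      ContinuousLinearMap.proj (R := ℝ) (φ := fun _ : (Finset.univ : Finset (Fin 4)) => ℝ)
        ⟨i, Finset.mem_univ i⟩)
  have key := integral_mul_four_of_hasGaussianLaw hlaw (fun _ => rfl) (fun _ _ => rfl)
  have e₁ : BoundedBorel.preimage
      (fun z : (E × E) × (F × F) => ((z.1.1, z.2.1), (z.1.2, z.2.2))) (by fun_prop) hb₁
      ((A.prod B).prod (A'.prod B')) = (A.prod A').prod (B.prod B') := by
    refine BoundedBorel.ext ?_
    ext z
    simp only [BoundedBorel.preimage, BoundedBorel.toSet, BoundedBorel.prod, Set.mem_preimage,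
      Set.mem_prod]
    tauto
  have e₂ : BoundedBorel.preimage
      (fun z : (E × F) × (E × F) => ((z.1.1, z.2.2), (z.2.1, z.1.2))) (by fun_prop) hb₂
      ((A.prod B).prod (A'.prod B')) = (A.prod B').prod (A'.prod B) := by
    refine BoundedBorel.ext ?_
    ext z
    simp only [BoundedBorel.preimage, BoundedBorel.toSet, BoundedBorel.prod, Set.mem_preimage,
      Set.mem_prod]
    tauto
  rw [e₁, e₂, hG₁', hG₂', hG₂', hG₃', hN', hN', h₁, h₂, h, h, h, h]
  simp only [inner_eq_integral_mul]
  refine key.trans ?_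
  simp [f]
  ring

/-- Existence of the tensor product. -/
theorem exists_isTensorRandomMeasure {M₁ : BoundedBorel E → Lp ℝ 2 P}
    {M₂ : BoundedBorel F → Lp ℝ 2 P} (hM₁ : IsRandomMeasure P M₁) (hM₂ : IsRandomMeasure P M₂)
    (hG : JointlyGaussian P M₁ M₂) (hC : HasCrossCovarianceMeasure P M₁ M₂) (o : E × F) :
    ∃ T, IsTensorRandomMeasure P M₁ M₂ T := by
  obtain ⟨G, hGσ, h⟩ := exists_fourthMoment hM₁ hM₂ hG hC o
  -- Gaussian variables lie in `L⁴`, so Hölder with `1/4 + 1/4 = 1/2` puts the product in `L²`.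
  have hmem : ∀ A B, MemLp (fun ω => M₁ A ω * M₂ B ω) 2 P := fun A B => by
    have h₁ : MemLp (M₁ A) 4 P := (hG.hasGaussianLaw_eval (Sum.inl A)).memLp (by norm_num)
    have h₂ : MemLp (M₂ B) 4 P := (hG.hasGaussianLaw_eval (Sum.inr B)).memLp (by norm_num)
    have : ENNReal.HolderTriple 4 4 2 := ⟨by
      rw [show (4 : ℝ≥0∞) = 2 * 2 by norm_num,
        ENNReal.mul_inv (by simp) (by simp), ← mul_add, ENNReal.inv_two_add_inv_two, mul_one]⟩
    exact h₂.mul' h₁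
  obtain ⟨T, hT, hTe, hTG⟩ := exists_isSigmaAdditive_of_gram_prod hGσ o
    (fun A B => (hmem A B).toLp _) fun A B A' B' => by
      rw [← h, inner_eq_integral_mul]
      refine integral_congr_ae ?_
      filter_upwards [(hmem A B).coeFn_toLp, (hmem A' B').coeFn_toLp] with ω h1 h2
      rw [h1, h2, ← mul_assoc]
  refine ⟨T, IsRandomMeasure.of_secondMoment hT o hGσ hTG, fun A B => ?_⟩
  rw [hTe]
  exact (hmem A B).coeFn_toLp

end Tensor

/-! ### Simple functions -/

section SimpleFn

variable {E F : Type*} [MeasurableSpace E] [PseudoMetricSpace E] [MeasurableSpace F]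
  [PseudoMetricSpace F] {Ω : Type*} [MeasurableSpace Ω] {P : Measure Ω}

/-- The union of two bounded Borel sets. -/
def BoundedBorel.union (A B : BoundedBorel E) : BoundedBorel E :=
  ⟨A.toSet ∪ B.toSet, A.measurableSet.union B.measurableSet, A.isBounded.union B.isBounded⟩

/-- The sum of two simple functions. -/
def SimpleFn.add (s t : SimpleFn E) : SimpleFn E :=
  ⟨s.size + t.size, Fin.append s.coeff t.coeff, Fin.append s.set t.set⟩

theorem SimpleFn.eval_add (s t : SimpleFn E) (x : E) :
    (s.add t).eval x = s.eval x + t.eval x := by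
  refine (Fin.sum_univ_add _).trans ?_
  simp only [SimpleFn.add, Fin.append_left, Fin.append_right]
  rfl

theorem SimpleFn.integral_add (s t : SimpleFn E) (M : BoundedBorel E → Lp ℝ 2 P) :
    (s.add t).integral M = s.integral M + t.integral M := by
  refine (Fin.sum_univ_add _).trans ?_
  simp only [SimpleFn.add, Fin.append_left, Fin.append_right]
  rfl

theorem SimpleFn.set_add_subset {s t : SimpleFn E} {D : Set E}
    (hs : ∀ i, (s.set i).toSet ⊆ D) (ht : ∀ i, (t.set i).toSet ⊆ D) (i) :
    ((s.add t).set i).toSet ⊆ D := by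
  refine Fin.addCases (fun i => ?_) (fun i => ?_) i
  · simpa only [SimpleFn.add, Fin.append_left] using hs i
  · simpa only [SimpleFn.add, Fin.append_right] using ht i

/-- The product of a simple function with a constant. -/
def SimpleFn.smul (c : ℂ) (s : SimpleFn E) : SimpleFn E :=
  ⟨s.size, fun i => c * s.coeff i, s.set⟩

theorem SimpleFn.eval_smul (c : ℂ) (s : SimpleFn E) (x : E) :
    (s.smul c).eval x = c * s.eval x := by
  simp only [SimpleFn.eval, SimpleFn.smul, Finset.mul_sum, Set.indicator_const_mul]
  rfl

theorem SimpleFn.integral_smul (c : ℂ) (s : SimpleFn E) (M : BoundedBorel E → Lp ℝ 2 P) :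
    (s.smul c).integral M = c • s.integral M := by
  simp only [SimpleFn.integral, SimpleFn.smul, Finset.smul_sum, mul_smul]
  rfl

/-- The product of a simple function with the indicator of a measurable set. -/
def SimpleFn.restrict (s : SimpleFn E) (U : Set E) (hU : MeasurableSet U) : SimpleFn E :=
  ⟨s.size, s.coeff, fun i => (s.set i).trace U hU⟩

theorem SimpleFn.eval_restrict (s : SimpleFn E) (U : Set E) (hU : MeasurableSet U) (x : E) :
    (s.restrict U hU).eval x = U.indicator s.eval x := by
  have h : ∀ i, ((s.set i).trace U hU).toSet.indicator (fun _ => s.coeff i) x =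
      U.indicator ((s.set i).toSet.indicator fun _ => s.coeff i) x := fun i => by
    rw [Set.indicator_indicator, BoundedBorel.toSet_trace]
  change ∑ i : Fin s.size, ((s.set i).trace U hU).toSet.indicator (fun _ => s.coeff i) x = _
  simp only [h]
  by_cases hx : x ∈ U <;> simp [SimpleFn.eval, hx]

/-- The product of a simple function with the indicator of a bounded Borel set of a second
space. -/
def SimpleFn.prodRight (s : SimpleFn E) (B : BoundedBorel F) : SimpleFn (E × F) :=
  ⟨s.size, s.coeff, fun i => (s.set i).prod B⟩

theorem SimpleFn.eval_prodRight (s : SimpleFn E) (B : BoundedBorel F) (z : E × F) :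
    (s.prodRight B).eval z = B.toSet.indicator (fun _ => s.eval z.1) z.2 := by
  have h : ∀ i, ((s.set i).prod B).toSet.indicator (fun _ => s.coeff i) z =
      B.toSet.indicator (fun _ => (s.set i).toSet.indicator (fun _ => s.coeff i) z.1) z.2 := by
    intro i
    by_cases h1 : z.1 ∈ (s.set i).toSet <;> by_cases h2 : z.2 ∈ B.toSet <;>
      simp [h1, h2, Set.indicator, Set.mem_prod]
  change ∑ i : Fin s.size, ((s.set i).prod B).toSet.indicator (fun _ => s.coeff i) z = _
  simp only [h]
  by_cases hz : z.2 ∈ B.toSet <;> simp [SimpleFn.eval, hz]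

end SimpleFn

/-! ### Bounded semivariation and the integral of deterministic functions. -/

section Integral

variable {E F : Type*} [MeasurableSpace E] [PseudoMetricSpace E] [MeasurableSpace F]
  [PseudoMetricSpace F] {Ω : Type*} [MeasurableSpace Ω] {P : Measure Ω}

theorem Approximates.add {s t : ℕ → SimpleFn E} {φ φ' : E → ℂ} (hs : Approximates s φ)
    (ht : Approximates t φ') :
    Approximates (fun n => (s n).add (t n)) (fun x => φ x + φ' x) := by
  obtain ⟨⟨D, hD⟩, hs⟩ := hs
  obtain ⟨⟨D', hD'⟩, ht⟩ := ht
  refine ⟨⟨D.union D', fun n => SimpleFn.set_add_subset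
    (fun i => (hD n i).trans Set.subset_union_left)
    (fun i => (hD' n i).trans Set.subset_union_right)⟩, ?_⟩
  have e : (fun n => ((s n).add (t n)).eval) = (fun n => (s n).eval) + fun n => (t n).eval :=
    funext fun n => funext fun x => SimpleFn.eval_add _ _ x
  rw [e]
  exact hs.add ht

theorem Approximates.smul {s : ℕ → SimpleFn E} {φ : E → ℂ} (hs : Approximates s φ) (c : ℂ) :
    Approximates (fun n => (s n).smul c) (fun x => c * φ x) := by
  obtain ⟨⟨D, hD⟩, hs⟩ := hs
  refine ⟨⟨D, hD⟩, ?_⟩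
  have e : (fun n => ((s n).smul c).eval) = fun n => (fun z : ℂ => c • z) ∘ (s n).eval :=
    funext fun n => funext fun x => SimpleFn.eval_smul c _ x
  rw [e]
  exact (uniformContinuous_const_smul (M := ℂ) (X := ℂ) c).comp_tendstoUniformly hs

theorem Approximates.restrict {s : ℕ → SimpleFn E} {φ : E → ℂ} (hs : Approximates s φ)
    {U : Set E} (hU : MeasurableSet U) :
    Approximates (fun n => (s n).restrict U hU) (U.indicator φ) := by
  obtain ⟨⟨D, hD⟩, hs⟩ := hs
  refine ⟨⟨D, fun n i => Set.inter_subset_right.trans (hD n i)⟩, ?_⟩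
  rw [Metric.tendstoUniformly_iff] at hs ⊢
  intro ε hε
  filter_upwards [hs ε hε] with n hn x
  rw [SimpleFn.eval_restrict]
  by_cases hx : x ∈ U
  · simpa [hx] using hn x
  · simpa [hx] using hε

theorem Approximates.prodRight {s : ℕ → SimpleFn E} {φ : E → ℂ} (hs : Approximates s φ)
    (B : BoundedBorel F) :
    Approximates (fun n => (s n).prodRight B)
      (fun z => B.toSet.indicator (fun _ => φ z.1) z.2) := by
  obtain ⟨⟨D, hD⟩, hs⟩ := hs
  refine ⟨⟨D.prod B, fun n i => Set.prod_mono (hD n i) subset_rfl⟩, ?_⟩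
  rw [Metric.tendstoUniformly_iff] at hs ⊢
  intro ε hε
  filter_upwards [hs ε hε] with n hn z
  rw [SimpleFn.eval_prodRight]
  by_cases hz : z.2 ∈ B.toSet
  · simpa [hz] using hn z.1
  · simpa [hz] using hε

/-- `M` has bounded semivariation on every bounded set. -/
def BoundedSemivariation (M : BoundedBorel E → Lp ℝ 2 P) : Prop :=
  ∀ D : BoundedBorel E, ∃ C : ℝ, 0 ≤ C ∧ ∀ (s : SimpleFn E) (K : ℝ),
    (∀ i, (s.set i).toSet ⊆ D.toSet) → (∀ x, ‖s.eval x‖ ≤ K) → 0 ≤ K →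
      ‖s.integral M‖ ≤ C * K

/-- The squared norm of a real simple integral is the quadratic form of the second-moment measure.
It is dominated by `∫ s² dν ≤ ν(E) K²`. -/
theorem IsRandomMeasure.boundedSemivariation [OpensMeasurableSpace E] [SecondCountableTopology E]
    [IsProbabilityMeasure P] {M : BoundedBorel E → Lp ℝ 2 P} (hM : IsRandomMeasure P M) (o : E) :
    BoundedSemivariation M := by
  intro D
  obtain ⟨G, hG, hGM⟩ := hM.exists_secondMoment o
  obtain ⟨ν, hν, h⟩ := hG.exists_dominating o D
  have hreal : ∀ (s : SimpleFn E) (a : Fin s.size → ℝ) (K : ℝ),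
      (∀ i, (s.set i).toSet ⊆ D.toSet) →
      (∀ x, |∑ i, (s.set i).toSet.indicator (fun _ => a i) x| ≤ K) → 0 ≤ K →
      ‖∑ i, a i • M (s.set i)‖ ≤ √(ν.real Set.univ) * K := by
    intro s a K hs ha hK
    refine (sq_le_sq₀ (norm_nonneg _) (by positivity)).mp ?_
    have e : ‖∑ i, a i • M (s.set i)‖ ^ 2 =
        ∑ i, ∑ j, a i * a j * G ((s.set i).prod (s.set j)) := by
      rw [← real_inner_self_eq_norm_sq, sum_inner]
      refine Finset.sum_congr rfl fun i _ => ?_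
      rw [inner_sum]
      refine Finset.sum_congr rfl fun j _ => ?_
      rw [real_inner_smul_left, real_inner_smul_right, mul_assoc, hGM]
    rw [e, mul_pow, Real.sq_sqrt measureReal_nonneg]
    refine (h _ a s.set hs).trans ?_
    have : ∫ _, K ^ 2 ∂ν = ν.real Set.univ * K ^ 2 := by simp
    rw [← this]
    refine integral_mono_of_nonneg (ae_of_all _ fun x => sq_nonneg _) (integrable_const _)
      (ae_of_all _ fun x => ?_)
    exact sq_le_sq' (neg_le_of_abs_le (ha x)) (le_of_abs_le (ha x))
  -- One summand for the real part of the coefficients and one for the imaginary part.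
  refine ⟨√(ν.real Set.univ) + √(ν.real Set.univ), by positivity, fun s K hs hsK hK => ?_⟩
  let J : Lp ℝ 2 P →L[ℝ] Lp ℂ 2 P := Complex.ofRealCLM.compLpL 2 P
  have hJ : ∀ X, ‖J X‖ ≤ ‖X‖ := fun X =>
    (Complex.ofRealCLM.norm_compLp_le X).trans (by simp)
  have hdec : s.integral M = J (∑ i, (s.coeff i).re • M (s.set i)) +
      Complex.I • J (∑ i, (s.coeff i).im • M (s.set i)) := by
    simp only [SimpleFn.integral, map_sum, map_smul, Finset.smul_sum, ← Finset.sum_add_distrib]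
    refine Finset.sum_congr rfl fun i _ => ?_
    change s.coeff i • J (M (s.set i)) = _
    conv_lhs => rw [← Complex.re_add_im (s.coeff i), add_smul, mul_comm, mul_smul]
    rfl
  rw [hdec, add_mul]
  refine (norm_add_le _ _).trans (add_le_add ?_ ?_)
  · refine (hJ _).trans (hreal s _ K hs (fun x => ?_) hK)
    refine le_trans (le_of_eq ?_) ((Complex.abs_re_le_norm _).trans (hsK x))
    rw [SimpleFn.eval, Complex.re_sum]
    congr 1
    refine Finset.sum_congr rfl fun i _ => ?_
    by_cases hx : x ∈ (s.set i).toSet <;> simp [hx]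
  · rw [norm_smul, Complex.norm_I, one_mul]
    refine (hJ _).trans (hreal s _ K hs (fun x => ?_) hK)
    refine le_trans (le_of_eq ?_) ((Complex.abs_im_le_norm _).trans (hsK x))
    rw [SimpleFn.eval, Complex.im_sum]
    congr 1
    refine Finset.sum_congr rfl fun i _ => ?_
    by_cases hx : x ∈ (s.set i).toSet <;> simp [hx]

variable {M : BoundedBorel E → Lp ℝ 2 P}

/-- The integrals of two sequences of simple functions that have close uniform limits are close. -/
theorem Approximates.eventually_norm_integral_sub_le (hM : BoundedSemivariation M)
    {s t : ℕ → SimpleFn E} {φ : E → ℂ} (hs : Approximates s φ) (ht : Approximates t φ)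
    {ε : ℝ} (hε : 0 < ε) :
    ∃ N, ∀ n ≥ N, ∀ k ≥ N, ‖(s n).integral M - (t k).integral M‖ < ε := by
  obtain ⟨⟨D, hD⟩, hs⟩ := hs
  obtain ⟨⟨D', hD'⟩, ht⟩ := ht
  obtain ⟨C, hC, h⟩ := hM (D.union D')
  rw [Metric.tendstoUniformly_iff] at hs ht
  -- Both simple functions are within `δ` of `φ`, hence within `2δ` of each other. The `+ 1` allows
  -- `C = 0` and keeps the final inequality strict.
  set δ := ε / (2 * (C + 1)) with hδ
  have hδ0 : 0 < δ := by positivity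
  obtain ⟨N, hN⟩ := eventually_atTop.mp (hs δ hδ0)
  obtain ⟨N', hN'⟩ := eventually_atTop.mp (ht δ hδ0)
  refine ⟨max N N', fun n hn k hk => ?_⟩
  have e : (s n).integral M - (t k).integral M = ((s n).add ((t k).smul (-1))).integral M := by
    rw [SimpleFn.integral_add, SimpleFn.integral_smul, neg_one_smul, sub_eq_add_neg]
  rw [e]
  have hb := h ((s n).add ((t k).smul (-1))) (δ + δ)
    (SimpleFn.set_add_subset (fun i => (hD n i).trans Set.subset_union_left)
      (fun i => (hD' k i).trans Set.subset_union_right)) (fun x => ?_) (by positivity)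
  · refine hb.trans_lt ?_
    have : (C + 1) * (δ + δ) = ε := by
      rw [hδ]
      field_simp
      ring
    nlinarith
  · rw [SimpleFn.eval_add, SimpleFn.eval_smul, neg_one_mul, ← sub_eq_add_neg, ← dist_eq_norm]
    refine (dist_triangle_left _ _ (φ x)).trans (add_le_add ?_ ?_)
    · exact (hN n ((le_max_left _ _).trans hn) x).le
    · exact (hN' k ((le_max_right _ _).trans hk) x).le

/-- Under bounded semivariation, one approximating sequence decides the integral for all of them. -/
theorem Approximates.hasIntegral (hM : BoundedSemivariation M) {s : ℕ → SimpleFn E} {φ : E → ℂ}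
    (hs : Approximates s φ) {X : Lp ℂ 2 P}
    (hX : Tendsto (fun n => (s n).integral M) atTop (𝓝 X)) : HasIntegral M φ X where
  exists_approx := ⟨s, hs⟩
  tendsto t ht := by
    have : Tendsto (fun n => (s n).integral M - (t n).integral M) atTop (𝓝 0) := by
      rw [Metric.tendsto_atTop]
      intro ε hε
      obtain ⟨N, hN⟩ := hs.eventually_norm_integral_sub_le hM ht hε
      exact ⟨N, fun n hn => by simpa using hN n hn n hn⟩
    simpa using hX.sub this

theorem Approximates.exists_hasIntegral (hM : BoundedSemivariation M) {s : ℕ → SimpleFn E}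
    {φ : E → ℂ} (hs : Approximates s φ) : ∃ X, HasIntegral M φ X := by
  have : CauchySeq (fun n => (s n).integral M) := by
    rw [Metric.cauchySeq_iff]
    intro ε hε
    obtain ⟨N, hN⟩ := hs.eventually_norm_integral_sub_le hM hs hε
    exact ⟨N, fun n hn k hk => by simpa [dist_eq_norm] using hN n hn k hk⟩
  obtain ⟨X, hX⟩ := cauchySeq_tendsto_of_complete this
  exact ⟨X, hs.hasIntegral hM hX⟩

theorem HasIntegral.add (hM : BoundedSemivariation M) {φ φ' : E → ℂ} {X X' : Lp ℂ 2 P}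
    (h : HasIntegral M φ X) (h' : HasIntegral M φ' X') :
    HasIntegral M (fun x => φ x + φ' x) (X + X') := by
  obtain ⟨s, hs⟩ := h.exists_approx
  obtain ⟨t, ht⟩ := h'.exists_approx
  refine (hs.add ht).hasIntegral hM ?_
  simpa only [SimpleFn.integral_add] using (h.tendsto s hs).add (h'.tendsto t ht)

theorem HasIntegral.const_mul (hM : BoundedSemivariation M) {φ : E → ℂ} {X : Lp ℂ 2 P}
    (h : HasIntegral M φ X) (c : ℂ) : HasIntegral M (fun x => c * φ x) (c • X) := by
  obtain ⟨s, hs⟩ := h.exists_approx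
  refine (hs.smul c).hasIntegral hM ?_
  simpa only [SimpleFn.integral_smul] using (h.tendsto s hs).const_smul c

theorem HasIntegral.sub (hM : BoundedSemivariation M) {φ φ' : E → ℂ} {X X' : Lp ℂ 2 P}
    (h : HasIntegral M φ X) (h' : HasIntegral M φ' X') :
    HasIntegral M (fun x => φ x - φ' x) (X - X') := by
  simpa [sub_eq_add_neg] using h.add hM (h'.const_mul hM (-1))

theorem hasIntegral_zero (hM : BoundedSemivariation M) : HasIntegral M (fun _ => 0) 0 := by
  have hs : Approximates (fun _ => (⟨0, Fin.elim0, Fin.elim0⟩ : SimpleFn E)) (fun _ => 0) := by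
    refine ⟨⟨⟨∅, MeasurableSet.empty, Bornology.isBounded_empty⟩, fun _ i => i.elim0⟩, ?_⟩
    rw [Metric.tendstoUniformly_iff]
    exact fun ε hε => Eventually.of_forall fun n x => by simpa [SimpleFn.eval] using hε
  refine hs.hasIntegral hM ?_
  simp [SimpleFn.integral]

theorem HasIntegral.finset_sum (hM : BoundedSemivariation M) {ι : Type*} (t : Finset ι)
    {φ : ι → E → ℂ} {X : ι → Lp ℂ 2 P} (h : ∀ i, HasIntegral M (φ i) (X i)) :
    HasIntegral M (fun x => ∑ i ∈ t, φ i x) (∑ i ∈ t, X i) := by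
  classical
  induction t using Finset.induction_on with
  | empty => simpa using hasIntegral_zero hM
  | insert i t hi ih =>
    simp only [Finset.sum_insert hi]
    exact (h i).add hM ih

theorem HasIntegral.exists_indicator (hM : BoundedSemivariation M) {φ : E → ℂ} {X : Lp ℂ 2 P}
    (h : HasIntegral M φ X) {U : Set E} (hU : MeasurableSet U) :
    ∃ Y, HasIntegral M (U.indicator φ) Y := by
  obtain ⟨s, hs⟩ := h.exists_approx
  exact (hs.restrict hU).exists_hasIntegral hM

/-- The integrals of bounded functions supported in a fixed bounded set are bounded by a multiple
of the supremum norm. -/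
theorem BoundedSemivariation.exists_norm_le (hM : BoundedSemivariation M) (D : BoundedBorel E) :
    ∃ C : ℝ, 0 ≤ C ∧ ∀ (φ : E → ℂ) (X : Lp ℂ 2 P) (K : ℝ), HasIntegral M φ X →
      (∀ x ∉ D.toSet, φ x = 0) → (∀ x, ‖φ x‖ ≤ K) → 0 ≤ K → ‖X‖ ≤ C * K := by
  obtain ⟨C, hC, h⟩ := hM D
  refine ⟨C, hC, fun φ X K hX hφ hφK hK => ?_⟩
  obtain ⟨s, hs⟩ := hX.exists_approx
  -- The sets of `s` may leave `D`. Cutting them with `D` keeps the limit, since `φ` vanishes off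
  -- `D`, and makes the constant for `D` usable.
  have hs' := hs.restrict D.measurableSet
  rw [Set.indicator_eq_self.mpr (fun x hx => by_contra fun hxD => hx (hφ x hxD))] at hs'
  have ht := (hX.tendsto _ hs').norm
  refine le_of_forall_pos_le_add fun ε hε => ?_
  have hδ : 0 < ε / (C + 1) := by positivity
  refine le_of_tendsto ht ?_
  filter_upwards [Metric.tendstoUniformly_iff.mp hs'.2 _ hδ] with n hn
  refine (h _ (K + ε / (C + 1)) (fun i => Set.inter_subset_left) (fun x => ?_)
    (by positivity)).trans ?_
  · have := hn x
    rw [dist_comm, dist_eq_norm] at this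
    have h2 := norm_le_insert' (((s n).restrict D.toSet D.measurableSet).eval x) (φ x)
    linarith [hφK x]
  · have : C * (ε / (C + 1)) ≤ ε := by
      rw [mul_div_assoc', div_le_iff₀ (by positivity)]
      nlinarith
    linarith [mul_add C K (ε / (C + 1))]

end Integral

/-! ### Riemann systems -/

section Riemann

variable {E : Type*} [MeasurableSpace E] [PseudoMetricSpace E]

/-- A bounded Borel set of a proper space has finite tagged Borel partitions with small cells. -/
theorem BoundedBorel.exists_taggedPartition [ProperSpace E] [OpensMeasurableSpace E]
    (D : BoundedBorel E) {ε : ℝ} (hε : 0 < ε) :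
    ∃ (k : ℕ) (cell : Fin k → BoundedBorel E) (tag : Fin k → E),
      Pairwise (fun i j => Disjoint (cell i).toSet (cell j).toSet) ∧
      (⋃ j, (cell j).toSet) = D.toSet ∧ (∀ j, tag j ∈ (cell j).toSet) ∧
      ∀ j, Metric.ediam (cell j).toSet ≤ ENNReal.ofReal (2 * ε) := by
  classical
  rcases D.toSet.eq_empty_or_nonempty with hD | ⟨o, -⟩
  · exact ⟨0, Fin.elim0, Fin.elim0, fun i => i.elim0, by simp [hD], fun i => i.elim0,
      fun i => i.elim0⟩
  have : Nonempty E := ⟨o⟩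
  let f : ℕ → Set E := fun n => Metric.ball (TopologicalSpace.denseSeq E n) ε
  have hcov : closure D.toSet ⊆ ⋃ n, f n := fun x _ => by
    obtain ⟨n, hn⟩ := (TopologicalSpace.denseRange_denseSeq E).exists_dist_lt x hε
    exact Set.mem_iUnion.mpr ⟨n, hn⟩
  obtain ⟨t, ht⟩ := D.isBounded.isCompact_closure.elim_finite_subcover f
    (fun n => Metric.isOpen_ball) hcov
  have hm : ∀ n, MeasurableSet (disjointed f n) :=
    MeasurableSet.disjointed fun n => Metric.isOpen_ball.measurableSet
  let c : ℕ → BoundedBorel E := fun n => D.trace (disjointed f n) (hm n)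
  -- If finitely many balls cover `D`, the disjointed pieces beyond the largest of their indices
  -- miss `D`. Empty pieces are discarded because each cell needs a tag.
  have hfin : {n | (c n).toSet.Nonempty}.Finite := by
    refine (Set.finite_Iic (t.sup id)).subset fun n hn => ?_
    obtain ⟨x, hx, hxD⟩ := hn
    obtain ⟨i, hi, hxi⟩ := Set.mem_iUnion₂.mp (ht (subset_closure hxD))
    have hni : n ≤ i := by
      by_contra h
      rw [disjointed_apply] at hx
      exact hx.2 (by
        simp only [Finset.sup_set_eq_biUnion, Set.mem_iUnion]
        exact ⟨i, by simpa using h, hxi⟩)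
    exact hni.trans (Finset.le_sup (f := id) hi)
  let ι := hfin.toFinset
  let e := ι.equivFin
  have hne : ∀ j : ι, (c j).toSet.Nonempty := fun j => hfin.mem_toFinset.mp j.2
  refine ⟨ι.card, fun j => c (e.symm j), fun j => (hne (e.symm j)).some, fun i j hij => ?_, ?_,
    fun j => (hne (e.symm j)).some_mem, fun j => ?_⟩
  · have : ((e.symm i : ι) : ℕ) ≠ e.symm j := fun h => hij (e.symm.injective (Subtype.ext h))
    exact (disjoint_disjointed f this).mono Set.inter_subset_left Set.inter_subset_left
  · refine Set.Subset.antisymm (Set.iUnion_subset fun j => Set.inter_subset_right) fun x hx => ?_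
    have hx' : x ∈ ⋃ n, disjointed f n := by
      rw [iUnion_disjointed]
      exact hcov (subset_closure hx)
    obtain ⟨n, hn⟩ := Set.mem_iUnion.mp hx'
    have hxn : x ∈ (c n).toSet := ⟨hn, hx⟩
    refine Set.mem_iUnion.mpr ⟨e ⟨n, hfin.mem_toFinset.mpr ⟨x, hxn⟩⟩, ?_⟩
    simpa using hxn
  · refine Metric.ediam_le fun x hx y hy => ?_
    have hx' := disjointed_subset f _ hx.1
    have hy' := disjointed_subset f _ hy.1
    rw [edist_dist]
    refine ENNReal.ofReal_le_ofReal ?_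
    rw [two_mul]
    exact (dist_triangle_right _ _ _).trans (add_le_add (Metric.mem_ball.mp hx').le
      (Metric.mem_ball.mp hy').le)

theorem RiemannSystem.nonempty [ProperSpace E] [OpensMeasurableSpace E] (D : BoundedBorel E) :
    Nonempty (RiemannSystem D) := by
  choose k cell tag h1 h2 h3 h4 using fun n : ℕ =>
    D.exists_taggedPartition (ε := 1 / ((n : ℝ) + 1)) (by positivity)
  refine ⟨⟨k, cell, tag, h1, h2, h3, ?_⟩⟩
  have hlim : Tendsto (fun n : ℕ => ENNReal.ofReal (2 * (1 / ((n : ℝ) + 1)))) atTop (𝓝 0) := by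
    have := (tendsto_one_div_add_atTop_nhds_zero_nat (𝕜 := ℝ)).const_mul 2
    have := (ENNReal.continuous_ofReal.tendsto _).comp this
    rwa [mul_zero, ENNReal.ofReal_zero] at this
  exact tendsto_of_tendsto_of_tendsto_of_le_of_le tendsto_const_nhds hlim (fun n => zero_le)
    fun n => iSup_le (h4 n)

theorem RiemannSystem.eventually_dist_tag_lt {D : BoundedBorel E} (R : RiemannSystem D) {δ : ℝ}
    (hδ : 0 < δ) : ∀ᶠ n in atTop, ∀ j, ∀ y ∈ (R.cell n j).toSet, dist y (R.tag n j) < δ := by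
  have := R.mesh_tendsto.eventually_lt_const (ENNReal.ofReal_pos.mpr hδ)
  filter_upwards [this] with n hn j y hy
  have h : edist y (R.tag n j) < ENNReal.ofReal δ :=
    ((Metric.edist_le_ediam_of_mem hy (R.tag_mem n j)).trans (le_iSup (fun j => Metric.ediam
      (R.cell n j).toSet) j)).trans_lt hn
  rwa [edist_dist, ENNReal.ofReal_lt_ofReal_iff hδ] at h

theorem RiemannSystem.sum_indicator_of_mem {D : BoundedBorel E} (R : RiemannSystem D) {n : ℕ}
    {j : Fin (R.size n)} {y : E} (hy : y ∈ (R.cell n j).toSet) (g : Fin (R.size n) → ℂ) :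
    ∑ i, (R.cell n i).toSet.indicator (fun _ => g i) y = g j := by
  rw [Finset.sum_eq_single j]
  · simp [hy]
  · intro i _ hij
    exact Set.indicator_of_notMem (Set.disjoint_right.mp (R.disjoint n hij) hy) _
  · simp

theorem RiemannSystem.cell_subset {D : BoundedBorel E} (R : RiemannSystem D) (n : ℕ)
    (j : Fin (R.size n)) : (R.cell n j).toSet ⊆ D.toSet :=
  (Set.subset_iUnion (fun j => (R.cell n j).toSet) j).trans (R.iUnion_eq n).subset

theorem RiemannSystem.sum_indicator_of_notMem {D : BoundedBorel E} (R : RiemannSystem D) {n : ℕ}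
    {y : E} (hy : y ∉ D.toSet) (g : Fin (R.size n) → ℂ) :
    ∑ i, (R.cell n i).toSet.indicator (fun _ => g i) y = 0 :=
  Finset.sum_eq_zero fun _ _ => Set.indicator_of_notMem (fun h => hy (R.cell_subset n _ h)) _

/-- A continuous function with compact support is a uniform limit of simple functions with a common
bounded support. -/
theorem exists_approximates [ProperSpace E] [OpensMeasurableSpace E] {φ : E → ℂ}
    (hφ : Continuous φ) (hc : HasCompactSupport φ) : ∃ s : ℕ → SimpleFn E, Approximates s φ := by
  let D : BoundedBorel E :=
    ⟨tsupport φ, (isClosed_tsupport φ).measurableSet, hc.isCompact.isBounded⟩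
  obtain ⟨R⟩ := RiemannSystem.nonempty D
  refine ⟨fun n => ⟨R.size n, fun j => φ (R.tag n j), R.cell n⟩,
    ⟨D, fun n j => R.cell_subset n j⟩, ?_⟩
  rw [Metric.tendstoUniformly_iff]
  intro ε hε
  obtain ⟨δ, hδ, h⟩ := Metric.uniformContinuous_iff.mp 
    (hc.uniformContinuous_of_continuous hφ) ε hε
  filter_upwards [R.eventually_dist_tag_lt hδ] with n hn x
  by_cases hx : x ∈ D.toSet
  · rw [← R.iUnion_eq n] at hx
    obtain ⟨j, hj⟩ := Set.mem_iUnion.mp hx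
    rw [SimpleFn.eval, R.sum_indicator_of_mem hj fun j => φ (R.tag n j)]
    exact h (hn j x hj)
  · rw [SimpleFn.eval, R.sum_indicator_of_notMem hx fun j => φ (R.tag n j),
      image_eq_zero_of_notMem_tsupport hx]
    simpa using hε

end Riemann

/-! ### Iterated integrals -/

section Iterated

variable {E F : Type*} [MeasurableSpace E] [PseudoMetricSpace E] [MeasurableSpace F]
  [PseudoMetricSpace F] {Ω : Type*} [MeasurableSpace Ω] {P : Measure Ω}
  {M₁ : BoundedBorel E → Lp ℝ 2 P} {M₂ : BoundedBorel F → Lp ℝ 2 P}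
  {T : BoundedBorel (E × F) → Lp ℝ 2 P}

theorem SimpleFn.coeFn_integral {M : BoundedBorel E → Lp ℝ 2 P} (s : SimpleFn E) :
    ∀ᵐ ω ∂P, s.integral M ω = ∑ i, s.coeff i * (M (s.set i) ω : ℂ) := by
  have h1 : ∀ᵐ ω ∂P, ∀ i, (s.coeff i • Complex.ofRealCLM.compLp (M (s.set i)) : Lp ℂ 2 P) ω =
      s.coeff i * (M (s.set i) ω : ℂ) := by
    rw [ae_all_iff]
    intro i
    filter_upwards [Lp.coeFn_smul (s.coeff i) (Complex.ofRealCLM.compLp (M (s.set i))),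
      Complex.ofRealCLM.coeFn_compLp (M (s.set i))] with ω h h'
    rw [h, Pi.smul_apply, h', smul_eq_mul]
    rfl
  filter_upwards [h1, Lp.coeFn_fun_finsetSum Finset.univ
    fun i => (s.coeff i • Complex.ofRealCLM.compLp (M (s.set i)) : Lp ℂ 2 P)] with ω h h'
  rw [SimpleFn.integral, h']
  exact Finset.sum_congr rfl fun i _ => h i

/-- Integrals of a function of the first variable against the tensor product. -/
theorem coeFn_integral_prodRight
    (hT : ∀ (A : BoundedBorel E) (B : BoundedBorel F), ∀ᵐ ω ∂P, T (A.prod B) ω = M₁ A ω * M₂ B ω)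
    {φ : E → ℂ} {B : BoundedBorel F} {Z Y : Lp ℂ 2 P} (hZ : HasIntegral M₁ φ Z)
    (hY : HasIntegral T (fun z => B.toSet.indicator (fun _ => φ z.1) z.2) Y) :
    ∀ᵐ ω ∂P, Y ω = Z ω * (M₂ B ω : ℂ) := by
  obtain ⟨s, hs⟩ := hZ.exists_approx
  have h1 := tendstoInMeasure_of_tendsto_Lp (hZ.tendsto s hs)
  have h2 := tendstoInMeasure_of_tendsto_Lp (hY.tendsto _ (hs.prodRight B))
  -- Multiplication by `M₂ B` need not be continuous on `L²`, so the identity for simple functions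
  -- passes to the limit almost everywhere, along a common subsequence.
  obtain ⟨n₁, hn₁, h1⟩ := h1.exists_seq_tendsto_ae
  obtain ⟨n₂, hn₂, h2⟩ := (h2.comp hn₁.tendsto_atTop).exists_seq_tendsto_ae
  have h3 : ∀ᵐ ω ∂P, ∀ n, ((s n).prodRight B).integral T ω =
      (s n).integral M₁ ω * (M₂ B ω : ℂ) := by
    rw [ae_all_iff]
    intro n
    have h4 : ∀ᵐ ω ∂P, ∀ i, T (((s n).set i).prod B) ω = M₁ ((s n).set i) ω * M₂ B ω :=
      ae_all_iff.mpr fun i => hT _ _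
    filter_upwards [(s n).coeFn_integral (M := M₁), ((s n).prodRight B).coeFn_integral (M := T),
      h4] with ω e1 e2 e3
    rw [e1, e2, Finset.sum_mul]
    refine Finset.sum_congr rfl fun i _ => ?_
    change (s n).coeff i * (T (((s n).set i).prod B) ω : ℂ) = _
    rw [e3 i, Complex.ofReal_mul, mul_assoc]
  filter_upwards [h1, h2, h3] with ω t1 t2 e
  refine tendsto_nhds_unique t2 ?_
  simp only [Function.comp, e]
  exact (t1.comp hn₂.tendsto_atTop).mul_const _

end Iterated

/-! ### Riemann sums of a process as integrals against the tensor product. -/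

section StochIntegral

variable {E F : Type*} [MeasurableSpace E] [PseudoMetricSpace E] [MeasurableSpace F]
  [PseudoMetricSpace F] {Ω : Type*} [MeasurableSpace Ω] {P : Measure Ω}
  {M₁ : BoundedBorel E → Lp ℝ 2 P} {M₂ : BoundedBorel F → Lp ℝ 2 P}
  {T : BoundedBorel (E × F) → Lp ℝ 2 P}

/-- The Riemann sums over `D` of the process `y ↦ ∫ ψ(x, y) dM₁(x)` against `M₂` converge to the
integral of `ψ 𝟙_{E × D}` against the tensor product. -/
theorem tendsto_riemannSum (hTb : BoundedSemivariation T)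
    (hT : ∀ (A : BoundedBorel E) (B : BoundedBorel F), ∀ᵐ ω ∂P, T (A.prod B) ω = M₁ A ω * M₂ B ω)
    {ψ : E × F → ℂ} (hψ : UniformContinuous ψ) {A₀ : BoundedBorel E}
    (hψ₀ : ∀ x ∉ A₀.toSet, ∀ y, ψ (x, y) = 0) {Z : F → Lp ℂ 2 P}
    (hZ : ∀ y, HasIntegral M₁ (fun x => ψ (x, y)) (Z y)) {D : BoundedBorel F} {Y : Lp ℂ 2 P}
    (hY : HasIntegral T ((Prod.snd ⁻¹' D.toSet).indicator ψ) Y) (R : RiemannSystem D) :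
    Tendsto (fun n => eLpNorm (fun ω => R.sum Z M₂ n ω - Y ω) 2 P) atTop (𝓝 0) := by
  have hW : ∀ n (j : Fin (R.size n)), ∃ W, HasIntegral T
      (fun z => (R.cell n j).toSet.indicator (fun _ => ψ (z.1, R.tag n j)) z.2) W := by
    intro n j
    obtain ⟨s, hs⟩ := (hZ (R.tag n j)).exists_approx
    exact (hs.prodRight (R.cell n j)).exists_hasIntegral hTb
  choose W hW using hW
  have hsum : ∀ n, HasIntegral T (fun z => ∑ j, (R.cell n j).toSet.indicator
      (fun _ => ψ (z.1, R.tag n j)) z.2) (∑ j, W n j) := fun n =>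
    HasIntegral.finset_sum hTb Finset.univ (hW n)
  -- Each term of the Riemann sum agrees almost surely with some `W n j` in `L²`, so the sum can be
  -- compared with `Y` inside `Lp`.
  have heq : ∀ n, eLpNorm (fun ω => R.sum Z M₂ n ω - Y ω) 2 P =
      ENNReal.ofReal ‖∑ j, W n j - Y‖ := by
    intro n
    rw [Lp.norm_def, ENNReal.ofReal_toReal (Lp.eLpNorm_ne_top _)]
    refine eLpNorm_congr_ae ?_
    have h : ∀ᵐ ω ∂P, ∀ j, W n j ω = Z (R.tag n j) ω * (M₂ (R.cell n j) ω : ℂ) :=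
      ae_all_iff.mpr fun j => coeFn_integral_prodRight hT (hZ _) (hW n j)
    filter_upwards [h, Lp.coeFn_sub (∑ j, W n j) Y, Lp.coeFn_fun_finsetSum Finset.univ (W n)]
      with ω h1 h2 h3
    rw [h2, Pi.sub_apply, h3]
    simp only [h1]
    rfl
  simp only [heq]
  rw [← ENNReal.ofReal_zero]
  refine (ENNReal.continuous_ofReal.tendsto 0).comp ?_
  obtain ⟨C, hC, hbound⟩ := hTb.exists_norm_le (A₀.prod D)
  rw [Metric.tendsto_atTop']
  intro ε hε
  -- On a cell of diameter below `δ`, replacing `y` by the tag changes `ψ` by less than `ε / (C +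
  -- 1)`, and both functions vanish off `A₀ × D`.
  obtain ⟨δ, hδ, h⟩ := Metric.uniformContinuous_iff.mp hψ (ε / (C + 1)) (by positivity)
  obtain ⟨N, hN⟩ := eventually_atTop.mp (R.eventually_dist_tag_lt hδ)
  refine ⟨N, fun n hn => ?_⟩
  rw [Real.dist_eq, sub_zero, abs_norm]
  refine (hbound _ _ (ε / (C + 1)) ((hsum n).sub hTb hY) ?_ ?_ (by positivity)).trans_lt ?_
  · rintro ⟨x, y⟩ hz
    by_cases hy : y ∈ D.toSet
    · have hx : x ∉ A₀.toSet := fun hx => hz ⟨hx, hy⟩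
      simp [Set.indicator, hψ₀ x hx]
    · rw [R.sum_indicator_of_notMem hy fun j => ψ (x, R.tag n j)]
      simp [hy]
  · rintro ⟨x, y⟩
    by_cases hy : y ∈ D.toSet
    · have hy' := hy
      rw [← R.iUnion_eq n] at hy'
      obtain ⟨j, hj⟩ := Set.mem_iUnion.mp hy'
      rw [R.sum_indicator_of_mem hj fun j => ψ (x, R.tag n j),
        Set.indicator_of_mem (show (x, y) ∈ Prod.snd ⁻¹' D.toSet from hy), ← dist_eq_norm]
      refine (h ?_).le
      rw [Prod.dist_eq, dist_self, max_eq_right dist_nonneg, dist_comm]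
      exact hN n hn.le j y hj
    · rw [R.sum_indicator_of_notMem hy fun j => ψ (x, R.tag n j)]
      simp only [Set.mem_preimage, hy, not_false_eq_true, Set.indicator_of_notMem, sub_zero,
        norm_zero]
      positivity
  · rw [mul_div_assoc', div_lt_iff₀ (by positivity)]
    nlinarith

variable [ProperSpace F] [OpensMeasurableSpace E] [OpensMeasurableSpace F]

/-- The iterated integral of a continuous function with compact support is its integral against the
tensor product. -/
theorem hasStochIntegral_of_tensor (hM₁ : BoundedSemivariation M₁) (hTb : BoundedSemivariation T)
    (hT : ∀ (A : BoundedBorel E) (B : BoundedBorel F), ∀ᵐ ω ∂P, T (A.prod B) ω = M₁ A ω * M₂ B ω)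
    (o : E × F) {ψ : E × F → ℂ} (hψ : Continuous ψ) (hc : HasCompactSupport ψ) {Z : F → Lp ℂ 2 P}
    (hZ : ∀ y, HasIntegral M₁ (fun x => ψ (x, y)) (Z y)) {X : Lp ℂ 2 P}
    (hX : HasIntegral T ψ X) : HasStochIntegral Z M₂ X := by
  have huc := hc.uniformContinuous_of_continuous hψ
  obtain ⟨r, hr⟩ := hc.isCompact.isBounded.subset_closedBall o
  let A₀ := BoundedBorel.closedBall o.1 r
  let B₀ := BoundedBorel.closedBall o.2 r
  have hψ₀ : ∀ x y, ψ (x, y) ≠ 0 → x ∈ A₀.toSet ∧ y ∈ B₀.toSet := by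
    intro x y h
    have := hr (subset_tsupport ψ h)
    rwa [← closedBall_prod_same] at this
  have hA₀ : ∀ x ∉ A₀.toSet, ∀ y, ψ (x, y) = 0 := fun x hx y =>
    by_contra fun h => hx (hψ₀ x y h).1
  have hB₀ : ∀ y ∉ B₀.toSet, ∀ x, ψ (x, y) = 0 := fun y hy x =>
    by_contra fun h => hy (hψ₀ x y h).2
  refine ⟨fun y₀ => ?_, ⟨B₀, fun y hy => ?_⟩, fun D hD => ⟨RiemannSystem.nonempty D, ?_⟩⟩
  · obtain ⟨C, hC, hbound⟩ := hM₁.exists_norm_le A₀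
    rw [Metric.tendsto_nhds_nhds]
    intro ε hε
    obtain ⟨δ, hδ, h⟩ := Metric.uniformContinuous_iff.mp huc (ε / (C + 1)) (by positivity)
    refine ⟨δ, hδ, fun y hy => ?_⟩
    rw [dist_eq_norm]
    refine (hbound _ _ (ε / (C + 1)) ((hZ y).sub hM₁ (hZ y₀)) (fun x hx => ?_) (fun x => ?_)
      (by positivity)).trans_lt ?_
    · simp [hA₀ x hx]
    · rw [← dist_eq_norm]
      refine (h ?_).le
      rwa [Prod.dist_eq, dist_self, max_eq_right dist_nonneg]
    · rw [mul_div_assoc', div_lt_iff₀ (by positivity)]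
      nlinarith
  · have := hZ y
    simp only [hB₀ y hy] at this
    exact this.unique (hasIntegral_zero hM₁)
  -- `Z y = 0` does not force `ψ(·, y) = 0`, so `ψ` need not vanish off `E × D`. The integral of `ψ`
  -- over `E × (B₀ \ D)` has to be shown to be zero.
  · let D' : BoundedBorel F := ⟨B₀.toSet \ D.toSet,
      MeasurableSet.diff B₀.measurableSet D.measurableSet, B₀.isBounded.subset Set.sdiff_subset⟩
    obtain ⟨Y, hY⟩ := hX.exists_indicator hTb (measurable_snd D.measurableSet)
    obtain ⟨Y', hY'⟩ := hX.exists_indicator hTb (measurable_snd D'.measurableSet)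
    have hYX : X = Y + Y' := by
      refine hX.unique ?_
      convert hY.add hTb hY' using 1
      funext ⟨x, y⟩
      by_cases hy : y ∈ D.toSet
      · have : y ∉ D'.toSet := fun h => h.2 hy
        simp [hy, this]
      · by_cases hy' : y ∈ B₀.toSet
        · have : y ∈ D'.toSet := ⟨hy', hy⟩
          simp [hy, this]
        · have : y ∉ D'.toSet := fun h => hy' h.1
          simp [hy, this, hB₀ y hy']
    have hY'0 : Y' = 0 := by
      obtain ⟨R⟩ := RiemannSystem.nonempty D'
      have h := tendsto_riemannSum hTb hT huc hA₀ hZ hY' R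
      -- All tags lie in `D'`, where `Z` is null, so every Riemann sum over `D'` vanishes while
      -- these sums converge to `Y'`.
      have h0 : ∀ n, eLpNorm (fun ω => R.sum Z M₂ n ω - Y' ω) 2 P = eLpNorm Y' 2 P := by
        intro n
        have hz : ∀ᵐ ω ∂P, ∀ j, Z (R.tag n j) ω = 0 := by
          rw [ae_all_iff]
          intro j
          rw [hD _ (R.cell_subset n j (R.tag_mem n j)).2]
          exact Lp.coeFn_zero ℂ 2 P
        rw [← eLpNorm_neg]
        refine eLpNorm_congr_ae ?_
        filter_upwards [hz] with ω h
        simp [RiemannSystem.sum, h]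
      simp only [h0] at h
      have := tendsto_nhds_unique tendsto_const_nhds h
      rw [← norm_eq_zero, Lp.norm_def, this, ENNReal.toReal_zero]
    rw [hYX, hY'0, add_zero]
    exact fun R => tendsto_riemannSum hTb hT huc hA₀ hZ hY R

end StochIntegral

/-! ### Exchange of the variables -/

section Swap

variable {E F : Type*} [MeasurableSpace E] [PseudoMetricSpace E] [MeasurableSpace F]
  [PseudoMetricSpace F] {Ω : Type*} [MeasurableSpace Ω] {P : Measure Ω}

theorem isBounded_preimage_swap {E F : Type*} [PseudoMetricSpace E] [PseudoMetricSpace F]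
    (U : Set (F × E)) (hU : Bornology.IsBounded U) :
    Bornology.IsBounded (Prod.swap ⁻¹' U : Set (E × F)) := by
  have h : Isometry (Prod.swap : E × F → F × E) := Isometry.of_dist_eq fun x y => by
    simp only [Prod.dist_eq, Prod.fst_swap, Prod.snd_swap, max_comm]
  exact h.antilipschitz.isBounded_preimage hU

/-- The image of a bounded Borel set under the exchange of the variables. -/
def BoundedBorel.swap (U : BoundedBorel (F × E)) : BoundedBorel (E × F) :=
  U.preimage Prod.swap measurable_swap isBounded_preimage_swap

/-- The exchange of the variables in a simple function. -/
def SimpleFn.swap (s : SimpleFn (F × E)) : SimpleFn (E × F) :=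
  ⟨s.size, s.coeff, fun i => (s.set i).swap⟩

variable {T : BoundedBorel (E × F) → Lp ℝ 2 P}

theorem BoundedSemivariation.swap (hT : BoundedSemivariation T) :
    BoundedSemivariation (fun U : BoundedBorel (F × E) => T U.swap) := by
  intro D
  obtain ⟨C, hC, h⟩ := hT D.swap
  refine ⟨C, hC, fun s K hs hsK hK => ?_⟩
  exact h s.swap K (fun i => Set.preimage_mono (hs i)) (fun x => hsK x.swap) hK

/-- Lets the second iterated integral reuse the argument for the first, with the value `X`
unchanged. -/
theorem HasIntegral.swap (hT : BoundedSemivariation T) {ψ : E × F → ℂ} {X : Lp ℂ 2 P}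
    (hX : HasIntegral T ψ X) :
    HasIntegral (fun U : BoundedBorel (F × E) => T U.swap) (fun z => ψ z.swap) X := by
  obtain ⟨s, ⟨D, hD⟩, hs⟩ := hX.exists_approx
  have hs' : Approximates (fun n => (s n).swap) (fun z : F × E => ψ z.swap) :=
    ⟨⟨D.swap, fun n i => Set.preimage_mono (hD n i)⟩, fun u hu => by
      filter_upwards [hs u hu] with n hn z using hn z.swap⟩
  exact hs'.hasIntegral hT.swap (hX.tendsto s ⟨⟨D, hD⟩, hs⟩)

end Swap

theorem hasCompactSupport_prodMk_left {E F : Type*} [PseudoMetricSpace E] [PseudoMetricSpace F]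
    {ψ : E × F → ℂ} (hc : HasCompactSupport ψ) (y : F) : HasCompactSupport fun x => ψ (x, y) :=
  HasCompactSupport.of_support_subset_isCompact (hc.isCompact.image continuous_fst)
    fun x hx => ⟨(x, y), subset_tsupport ψ hx, rfl⟩

theorem exists_hasIntegral_prodMk_left {E F : Type*} [MeasurableSpace E] [PseudoMetricSpace E]
    [PseudoMetricSpace F] [ProperSpace E] [OpensMeasurableSpace E] {Ω : Type*} [MeasurableSpace Ω]
    {P : Measure Ω} {M : BoundedBorel E → Lp ℝ 2 P} (hM : BoundedSemivariation M) {ψ : E × F → ℂ}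
    (hψ : Continuous ψ) (hc : HasCompactSupport ψ) (y : F) :
    ∃ Z, HasIntegral M (fun x => ψ (x, y)) Z := by
  obtain ⟨s, hs⟩ := exists_approximates (hψ.comp (.prodMk_left y))
    (hasCompactSupport_prodMk_left hc y)
  exact hs.exists_hasIntegral hM

end RandomMeasures

/-! ### The theorem. -/

open RandomMeasures
theorem mainTheorem7 {Ω : Type*} [MeasurableSpace Ω] (P : Measure Ω) [IsProbabilityMeasure P]
    (d p : ℕ)
    (M₁ : BoundedBorel (EuclideanSpace ℝ (Fin d)) → Lp ℝ 2 P)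
    (M₂ : BoundedBorel (EuclideanSpace ℝ (Fin p)) → Lp ℝ 2 P)
    (hM₁ : IsRandomMeasure P M₁) (hM₂ : IsRandomMeasure P M₂)
    (hG : JointlyGaussian P M₁ M₂) (hC : HasCrossCovarianceMeasure P M₁ M₂) :
    ∃ T : BoundedBorel (EuclideanSpace ℝ (Fin d) × EuclideanSpace ℝ (Fin p)) → Lp ℝ 2 P,
      -- `T` is the tensor product `M₁ ⊗ M₂`
      IsTensorRandomMeasure P M₁ M₂ T ∧ (∀ T', IsTensorRandomMeasure P M₁ M₂ T' → T' = T) ∧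
      ∀ ψ : EuclideanSpace ℝ (Fin d) × EuclideanSpace ℝ (Fin p) → ℂ,
        Continuous ψ → HasCompactSupport ψ →
        ∃ (Z₁ : EuclideanSpace ℝ (Fin p) → Lp ℂ 2 P) (Z₂ : EuclideanSpace ℝ (Fin d) → Lp ℂ 2 P)
          (X : Lp ℂ 2 P),
          (∀ y, HasIntegral M₁ (fun x => ψ (x, y)) (Z₁ y)) ∧
          (∀ x, HasIntegral M₂ (fun y => ψ (x, y)) (Z₂ x)) ∧
          HasIntegral T ψ X ∧
          HasStochIntegral Z₁ M₂ X ∧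
          HasStochIntegral Z₂ M₁ X := by
  let o : EuclideanSpace ℝ (Fin d) × EuclideanSpace ℝ (Fin p) := 0
  obtain ⟨T, hT⟩ := exists_isTensorRandomMeasure hM₁ hM₂ hG hC o
  refine ⟨T, hT, fun T' hT' => hT.unique hT' o, fun ψ hψ hc => ?_⟩
  have b₁ := hM₁.boundedSemivariation o.1
  have b₂ := hM₂.boundedSemivariation o.2
  have b := hT.isRandomMeasure.boundedSemivariation o
  have hψ' : Continuous fun z : EuclideanSpace ℝ (Fin p) × EuclideanSpace ℝ (Fin d) => ψ z.swap :=
    hψ.comp continuous_swap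
  have hc' : HasCompactSupport
      fun z : EuclideanSpace ℝ (Fin p) × EuclideanSpace ℝ (Fin d) => ψ z.swap :=
    hc.comp_homeomorph (Homeomorph.prodComm _ _)
  choose Z₁ hZ₁ using exists_hasIntegral_prodMk_left b₁ hψ hc
  choose Z₂ hZ₂ using exists_hasIntegral_prodMk_left b₂ hψ' hc'
  obtain ⟨s, hs⟩ := exists_approximates hψ hc
  obtain ⟨X, hX⟩ := hs.exists_hasIntegral b
  refine ⟨Z₁, Z₂, X, hZ₁, hZ₂, hX, ?_, ?_⟩
  · exact hasStochIntegral_of_tensor b₁ b hT.apply_prod o hψ hc hZ₁ hX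
  -- The transposed set function `U ↦ T U.swap` satisfies the product identity for `M₂`, `M₁`, and
  -- its integral of the transposed `ψ` is still `X`.
  · refine hasStochIntegral_of_tensor b₂ b.swap (fun B A => ?_) o.swap hψ' hc' hZ₂ (hX.swap b)
    have e : (B.prod A).swap = A.prod B := BoundedBorel.ext (Set.preimage_swap_prod _ _)
    filter_upwards [hT.apply_prod A B] with ω h
    rw [e, h, mul_comm]
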